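/- Let $\xi\colon[0,1]\to[0,1]$ be the standard Cantor function, let $(u_j,v_j)$ be its constancy intervals (the maximal open subintervals of $[0,1]$ on which $\xi$ is constant), and let $T(x)=x+\xi(x)$. Define the Hamiltonian of the Cantor string on $[0,2]$ by \[ \mathcal H(x)=\begin{pmatrix}1&0\\0&0\end{pmatrix}\ \text{ if } x\in\bigcup_j T([u_j,v_j]),\qquad \mathcal H(x)=\begin{pmatrix}0&0\\0&1\end{pmatrix}\ \text{ otherwise.} \] Then $(\mathcal H,2)$ is a canonical system, i.e. $\mathcal H$ is summable on $[0,2]$, and $\mathcal H(x)\ge 0$ and $\operatorname{tr}\mathcal H(x)=1$ for a.e. $x \in [0,2]$. Let $J=\begin{pmatrix}0&-1\\1&0\end{pmatrix}$, and for $z\in\mathbb C$ let $M(x,z)$ be the $2\times2$ matrix solution (absolutely continuous in $x$) of \[ J\,\frac{d}{dx}M(x,z)=z\,\mathcal H(x)M(x,z)\quad\text{for a.e. }x\in[0,2],\qquad M(0,z)=I. \] Then the order of this canonical system equals $2/\log_2 6$, that is, $M$ exists and for all $i,j\in\{1,2\}$ \[ \limsup_{|z|\to\infty}\frac{\log^+\log^+|M_{ij}(2,z)|}{\log|z|}=\frac{2}{\log_2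 6},\qquad \log^+ t=\max(\log t,0)\ (t>0),\quad \log^+0=0. \] -/

import Mathlib

open MeasureTheory Set Filter
open scoped ComplexOrder

/-- The successive approximations of the Cantor function, started from the zero function. -/
noncomputable def cantorApprox : ℕ → ℝ → ℝ
  | 0, _ => 0
  | n + 1, x =>
    if x ≤ 1 / 3 then cantorApprox n (3 * x) / 2
    else if x < 2 / 3 then 1 / 2
    else (1 + cantorApprox n (3 * x - 2)) / 2

/-- The standard Cantor function on `[0, 1]` (extended by `0` to the left and by `1` to the right).
It is the limit of its approximations, which increase and are bounded by `1`. -/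
noncomputable def cantorFunction (x : ℝ) : ℝ := ⨆ n, cantorApprox n x

theorem cantorApprox_mem (n : ℕ) (x : ℝ) : 0 ≤ cantorApprox n x ∧ cantorApprox n x ≤ 1 := by
  induction n generalizing x with
  | zero => simp [cantorApprox]
  | succ n ih =>
    have h1 := ih (3 * x)
    have h2 := ih (3 * x - 2)
    simp only [cantorApprox]
    split_ifs <;> constructor <;> linarith

theorem cantorApprox_le_succ (n : ℕ) (x : ℝ) : cantorApprox n x ≤ cantorApprox (n + 1) x := by
  induction n generalizing x with
  | zero => exact (cantorApprox_mem 1 x).1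
  | succ n ih =>
    have h1 := ih (3 * x)
    have h2 := ih (3 * x - 2)
    rw [cantorApprox, cantorApprox]
    split_ifs <;> linarith

/-- The supremum in the definition of the Cantor function is a genuine limit. -/
theorem tendsto_cantorApprox (x : ℝ) :
    Tendsto (fun n => cantorApprox n x) atTop (nhds (cantorFunction x)) :=
  tendsto_atTop_ciSup (monotone_nat_of_le_succ fun n => cantorApprox_le_succ n x)
    ⟨1, by rintro _ ⟨n, rfl⟩; exact (cantorApprox_mem n x).2⟩

/-- The self-similarity of the Cantor function. -/
theorem cantorFunction_eq (x : ℝ) :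
    cantorFunction x =
      if x ≤ 1 / 3 then cantorFunction (3 * x) / 2
      else if x < 2 / 3 then 1 / 2
      else (1 + cantorFunction (3 * x - 2)) / 2 := by
  refine tendsto_nhds_unique ((tendsto_add_atTop_iff_nat 1).2 (tendsto_cantorApprox x)) ?_
  simp only [cantorApprox]
  split_ifs
  · exact (tendsto_cantorApprox _).div_const 2
  · exact tendsto_const_nhds
  · exact ((tendsto_cantorApprox _).const_add 1).div_const 2

/-- `(u, v)` is a constancy interval of `f` on `[0, 1]`: a maximal nonempty open subinterval of
`[0, 1]` on which `f` is constant. -/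
structure IsConstancyInterval (f : ℝ → ℝ) (u v : ℝ) : Prop where
  zero_le : 0 ≤ u
  lt : u < v
  le_one : v ≤ 1
  const : ∀ x ∈ Ioo u v, ∀ y ∈ Ioo u v, f x = f y
  maximal : ∀ u' v', 0 ≤ u' → u' ≤ u → v ≤ v' → v' ≤ 1 →
    (∀ x ∈ Ioo u' v', ∀ y ∈ Ioo u' v', f x = f y) → u' = u ∧ v' = v

/-- The map `T(x) = x + ξ(x)`, with `ξ` the Cantor function. -/
noncomputable def cantorShift (x : ℝ) : ℝ := x + cantorFunction x

/-- The union of the images `T([u, v])` over the constancy intervals `(u, v)` of the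
Cantor function. -/
def cantorStringSet : Set ℝ :=
  ⋃ (u : ℝ) (v : ℝ) (_ : IsConstancyInterval cantorFunction u v), cantorShift '' Icc u v

open Classical in
/-- The Hamiltonian of the Cantor string. -/
noncomputable def cantorHamiltonian (x : ℝ) : Matrix (Fin 2) (Fin 2) ℂ :=
  if x ∈ cantorStringSet then !![1, 0; 0, 0] else !![0, 0; 0, 1]

/-- The symplectic matrix `J`. -/
def symplJ : Matrix (Fin 2) (Fin 2) ℂ := !![0, -1; 1, 0]

/-- `(H, L)` is a (trace-normed) canonical system: `H` is summable on `[0, L]`, and a.e. on `[0, L]`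
nonnegative with trace `1`. -/
structure IsCanonicalSystem (H : ℝ → Matrix (Fin 2) (Fin 2) ℂ) (L : ℝ) : Prop where
  pos : 0 < L
  integrable : ∀ i j, IntegrableOn (fun x => H x i j) (Icc 0 L)
  nonneg : ∀ᵐ x ∂(volume.restrict (Icc 0 L)), (H x).PosSemidef
  trace_eq_one : ∀ᵐ x ∂(volume.restrict (Icc 0 L)), (H x).trace = 1

/-- `M z x` is, for each `z`, the solution of `J dM/dx = z H M` on `[0, L]` with value `I` at
`x = 0`. The equation is understood in the usual (Carathéodory) sense: integrated from `0` to `x`,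
for a continuous function `M z` on `[0, L]`. -/
structure IsMatrixSolution (H : ℝ → Matrix (Fin 2) (Fin 2) ℂ) (L : ℝ)
    (M : ℂ → ℝ → Matrix (Fin 2) (Fin 2) ℂ) : Prop where
  continuousOn : ∀ z, ContinuousOn (M z) (Icc 0 L)
  integral_eq : ∀ z, ∀ x ∈ Icc 0 L, ∀ i j,
    (symplJ * (M z x - 1)) i j = z * ∫ t in (0 : ℝ)..x, (H t * M z t) i j

/-- The order `limsup log log |f(z)| / log |z|`, as `|z| → ∞`, of an entire function `f`. Both
logarithms in the numerator are replaced by their positive parts, so that points where `|f(z)|` is small do not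
contribute. -/
noncomputable def entireOrder (f : ℂ → ℂ) : EReal :=
  limsup (fun z : ℂ => ((Real.posLog (Real.posLog ‖f z‖) / Real.log ‖z‖ : ℝ) : EReal))
    (Bornology.cobounded ℂ)

/-- The canonical system `(H, L)` has order `ρ`: the monodromy matrix `M(L, z)` exists, and each of
its entries has order `ρ`. -/
def HasOrder (H : ℝ → Matrix (Fin 2) (Fin 2) ℂ) (L : ℝ) (ρ : EReal) : Prop :=
  (∃ M, IsMatrixSolution H L M) ∧
    ∀ M, IsMatrixSolution H L M → ∀ i j, entireOrder (fun z => M z L i j) = ρ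

/-! Write `α` for Lebesgue measure on the string set (`cantorMass`) and `β` for Lebesgue measure on
its complement (`cantorLength`). For a column of `M`, let `u` be its first entry and `v` its second
entry times `z`. The canonical system becomes the string equation `du = v dβ`, `dv = w u dα` with `w
= -z ^ 2`.

Under `T`, `α` corresponds to Lebesgue measure on `[0, 1]` and `β` to the Cantor measure. The maps
of `[0, 1]` onto its outer thirds contract them by `1/3` and `1/2`, so restricting a solution to an
outer third gives a solution with parameter `w / 6`, up to a factor 2 in `v`. The middle third
carries mass `1/3` and no length. Hence the transfer matrix at `w` is a product of two conjugates of
the one at `w / 6` with a unipotent matrix of entry `w / 3` between them (`cantorEntry_eq`).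

Multiplying `w` by 6 therefore essentially squares the entries: the logarithm of their size doubles
each time `|z|` grows by `√6`. This gives the order `log 2 / log √6 = 2 / log_2 6`. The upper bound
is an induction with a weight that absorbs the factor `w` (`exists_norm_cantorEntry_mul_le`). For
the lower bound take `z` imaginary, so that `w > 0`: the Taylor coefficients in `w` are nonnegative,
no cancellation occurs, and the diagonal entries at least square (`pow_le_norm_cantorEntry`).
`entireOrder_eq_of_bounds` turns both bounds into the order. -/

/-! ### The Cantor function: monotonicity, values, continuity -/

theorem cantorApprox_monotone (n : ℕ) : Monotone (cantorApprox n) := by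
  induction n with
  | zero => intro x y _; simp [cantorApprox]
  | succ n ih =>
    intro x y hxy
    have h1 := cantorApprox_mem n (3 * x)
    have h2 := cantorApprox_mem n (3 * y - 2)
    have h3 := @ih (3 * x) (3 * y) (by linarith)
    have h4 := @ih (3 * x - 2) (3 * y - 2) (by linarith)
    simp only [cantorApprox]
    split_ifs <;> linarith

theorem cantorFunction_monotone : Monotone cantorFunction := fun x y hxy =>
  le_of_tendsto_of_tendsto' (tendsto_cantorApprox x) (tendsto_cantorApprox y)
    fun n => cantorApprox_monotone n hxy

theorem cantorFunction_of_nonpos {x : ℝ} (hx : x ≤ 0) : cantorFunction x = 0 := by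
  have h : ∀ n x, x ≤ 0 → cantorApprox n x = 0 := by
    intro n
    induction n with
    | zero => intro x _; rfl
    | succ n ih =>
      intro x hx
      rw [cantorApprox, if_pos (by linarith), ih _ (by linarith), zero_div]
  exact tendsto_nhds_unique (tendsto_cantorApprox x)
    (by simp only [fun n => h n x hx]; exact tendsto_const_nhds)

theorem cantorFunction_of_one_le {x : ℝ} (hx : 1 ≤ x) : cantorFunction x = 1 := by
  have h : ∀ n x, 1 ≤ x → cantorApprox n x = 1 - (1 / 2) ^ n := by
    intro n
    induction n with
    | zero => intro x _; simp [cantorApprox]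
    | succ n ih =>
      intro x hx
      rw [cantorApprox, if_neg (by linarith), if_neg (by linarith), ih _ (by linarith)]
      ring
  refine tendsto_nhds_unique (tendsto_cantorApprox x) ?_
  simp only [fun n => h n x hx]
  simpa using (tendsto_pow_atTop_nhds_zero_of_lt_one (r := (1 / 2 : ℝ)) (by norm_num)
    (by norm_num)).const_sub 1

theorem cantorFunction_nonneg (x : ℝ) : 0 ≤ cantorFunction x := by
  rw [← cantorFunction_of_nonpos (min_le_right x 0)]
  exact cantorFunction_monotone (min_le_left _ _)

theorem cantorFunction_le_one (x : ℝ) : cantorFunction x ≤ 1 := by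
  rw [← cantorFunction_of_one_le (le_max_right x 1)]
  exact cantorFunction_monotone (le_max_left _ _)

theorem cantorFunction_middle {x : ℝ} (h1 : 1 / 3 ≤ x) (h2 : x ≤ 2 / 3) :
    cantorFunction x = 1 / 2 := by
  rw [cantorFunction_eq]
  split_ifs with h h'
  · rw [cantorFunction_of_one_le (by linarith)]
  · rfl
  · rw [cantorFunction_of_nonpos (by linarith)]; norm_num

theorem cantorFunction_left {x : ℝ} (h : x ≤ 1 / 3) :
    cantorFunction x = cantorFunction (3 * x) / 2 := by
  rw [cantorFunction_eq, if_pos h]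

theorem cantorFunction_right {x : ℝ} (h : 2 / 3 ≤ x) :
    cantorFunction x = (1 + cantorFunction (3 * x - 2)) / 2 := by
  rw [cantorFunction_eq, if_neg (by linarith), if_neg (by linarith)]

/-- Hölder continuity on triadic scales, by self-similarity: magnifying an outer third by 3 doubles
the increments. If only one endpoint lies in an outer third, the other is replaced by the nearer end
of the middle third. -/
theorem cantorFunction_sub_le (n : ℕ) : ∀ x y : ℝ, x ≤ y → y - x ≤ (1 / 3) ^ n →
    cantorFunction y - cantorFunction x ≤ (1 / 2) ^ n := by
  induction n with
  | zero =>
    intro x y _ _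
    have h1 := cantorFunction_nonneg x
    have h2 := cantorFunction_le_one y
    simp only [pow_zero]
    linarith
  | succ n ih =>
    intro x y hxy hd
    have hp : ((1 / 3 : ℝ)) ^ n ≤ 1 := pow_le_one₀ (by norm_num) (by norm_num)
    rw [pow_succ] at hd
    have h0 : (0 : ℝ) ≤ (1 / 2) ^ n := by positivity
    have h3 : (0 : ℝ) ≤ (1 / 3) ^ n := by positivity
    rw [pow_succ]
    rcases le_total y (1 / 3) with hy | hy
    · rw [cantorFunction_left hy, cantorFunction_left (hxy.trans hy)]
      have := ih (3 * x) (3 * y) (by linarith) (by linarith)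
      linarith
    rcases le_total (2 / 3) x with hx | hx
    · rw [cantorFunction_right hx, cantorFunction_right (hx.trans hxy)]
      have := ih (3 * x - 2) (3 * y - 2) (by linarith) (by linarith)
      linarith
    rcases le_total x (1 / 3) with hx' | hx'
    · rw [cantorFunction_middle hy (by linarith), cantorFunction_left hx']
      have := ih (3 * x) 1 (by linarith) (by linarith)
      rw [cantorFunction_of_one_le le_rfl] at this
      linarith
    rw [cantorFunction_middle hx' hx]
    rcases le_total y (2 / 3) with hy' | hy'
    · rw [cantorFunction_middle hy hy']; linarith
    rw [cantorFunction_right hy']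
    have := ih 0 (3 * y - 2) (by linarith) (by linarith)
    rw [cantorFunction_of_nonpos le_rfl] at this
    linarith

theorem continuous_cantorFunction : Continuous cantorFunction := by
  rw [Metric.continuous_iff]
  intro x ε hε
  obtain ⟨n, hn⟩ := exists_pow_lt_of_lt_one hε (by norm_num : (1 / 2 : ℝ) < 1)
  refine ⟨(1 / 3) ^ n, by positivity, fun y hy => lt_of_le_of_lt ?_ hn⟩
  rw [Real.dist_eq] at hy ⊢
  rcases le_total x y with h | h
  · rw [abs_of_nonneg (sub_nonneg.2 (cantorFunction_monotone h))]
    rw [abs_of_nonneg (sub_nonneg.2 h)] at hy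
    exact cantorFunction_sub_le n x y h hy.le
  · rw [abs_of_nonpos (sub_nonpos.2 (cantorFunction_monotone h)), neg_sub]
    rw [abs_of_nonpos (sub_nonpos.2 h), neg_sub] at hy
    exact cantorFunction_sub_le n y x h hy.le

/-! ### The homeomorphism `T` and its inverse -/

theorem cantorShift_strictMono : StrictMono cantorShift := fun _ _ h =>
  add_lt_add_of_lt_of_le h (cantorFunction_monotone h.le)

theorem continuous_cantorShift : Continuous cantorShift :=
  continuous_id.add continuous_cantorFunction

theorem cantorShift_surjective : Function.Surjective cantorShift := by
  refine continuous_cantorShift.surjective ?_ ?_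
  · exact tendsto_atTop_mono (fun x => le_add_of_nonneg_right (cantorFunction_nonneg x)) tendsto_id
  · exact tendsto_atBot_mono (fun x => add_le_add_right (cantorFunction_le_one x) x)
      (tendsto_atBot_add_const_right _ 1 tendsto_id)

/-- The map `T(x) = x + ξ(x)` as an order isomorphism of the line. -/
noncomputable def cantorShiftIso : ℝ ≃o ℝ :=
  cantorShift_strictMono.orderIsoOfSurjective _ cantorShift_surjective

theorem cantorShiftIso_apply (x : ℝ) : cantorShiftIso x = x + cantorFunction x := rfl

/-- The inverse of `T`. -/
noncomputable def cantorUnshift (x : ℝ) : ℝ := cantorShiftIso.symm x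

theorem cantorUnshift_add (x : ℝ) : cantorUnshift x + cantorFunction (cantorUnshift x) = x :=
  cantorShiftIso.apply_symm_apply x

theorem cantorUnshift_eq {x y : ℝ} (h : y + cantorFunction y = x) : cantorUnshift x = y := by
  rw [← h]; exact cantorShiftIso.symm_apply_apply y

theorem cantorUnshift_monotone : Monotone cantorUnshift := cantorShiftIso.symm.monotone

theorem continuous_cantorUnshift : Continuous cantorUnshift :=
  cantorShiftIso.symm.continuous

theorem cantorUnshift_zero : cantorUnshift 0 = 0 :=
  cantorUnshift_eq (by rw [cantorFunction_of_nonpos le_rfl, add_zero])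

theorem cantorUnshift_two : cantorUnshift 2 = 1 :=
  cantorUnshift_eq (by rw [cantorFunction_of_one_le le_rfl]; norm_num)

theorem cantorUnshift_mem {x : ℝ} (hx : x ∈ Icc (0 : ℝ) 2) : cantorUnshift x ∈ Icc (0 : ℝ) 1 :=
  ⟨cantorUnshift_zero ▸ cantorUnshift_monotone hx.1,
    cantorUnshift_two ▸ cantorUnshift_monotone hx.2⟩

/-- The increments of `f` lie between 0 and those of the identity. This applies to both summands of
`x = T⁻¹ x + ξ (T⁻¹ x)`. -/
theorem lipschitzWith_one_of_monotone_of_sub {f : ℝ → ℝ} (hf : Monotone f)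
    (hf' : Monotone fun x => x - f x) : LipschitzWith 1 f := by
  refine LipschitzWith.of_le_add fun x y => ?_
  rcases le_total x y with h | h
  · have := hf h
    have := dist_nonneg (x := x) (y := y)
    linarith
  · have := hf' h
    rw [Real.dist_eq, abs_of_nonneg (sub_nonneg.2 h)]
    simp only at this
    linarith

theorem sub_cantorUnshift (x : ℝ) : x - cantorUnshift x = cantorFunction (cantorUnshift x) := by
  rw [sub_eq_iff_eq_add', cantorUnshift_add]

theorem monotone_sub_cantorUnshift : Monotone fun x => x - cantorUnshift x := by
  simp only [sub_cantorUnshift]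
  exact cantorFunction_monotone.comp cantorUnshift_monotone

theorem lipschitzWith_cantorUnshift : LipschitzWith 1 cantorUnshift :=
  lipschitzWith_one_of_monotone_of_sub cantorUnshift_monotone monotone_sub_cantorUnshift

theorem lipschitzWith_sub_cantorUnshift : LipschitzWith 1 fun x => x - cantorUnshift x :=
  lipschitzWith_one_of_monotone_of_sub monotone_sub_cantorUnshift
    (by simpa using cantorUnshift_monotone)

/-! ### Plateaus and the measure of the string set -/

theorem volume_image_le_of_lipschitzWith_one {f : ℝ → ℝ} (hf : LipschitzWith 1 f) (s : Set ℝ) :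
    volume (f '' s) ≤ volume s := by
  have h := hf.hausdorffMeasure_image_le (d := 1) zero_le_one s
  simpa [hausdorffMeasure_real] using h

/-- The union of the closed nondegenerate subintervals of `[0, 1]` on which the Cantor function is
constant. -/
def cantorPlateaus : Set ℝ :=
  {y | ∃ u v, 0 ≤ u ∧ u < v ∧ v ≤ 1 ∧ cantorFunction u = cantorFunction v ∧ y ∈ Icc u v}

theorem cantorPlateaus_subset : cantorPlateaus ⊆ Icc 0 1 := by
  rintro y ⟨u, v, hu, -, hv, -, hy⟩
  exact ⟨hu.trans hy.1, hy.2.trans hv⟩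

theorem IsConstancyInterval.apply_eq {f : ℝ → ℝ} (hf : Continuous f) {u v : ℝ}
    (hc : ∀ x ∈ Ioo u v, ∀ y ∈ Ioo u v, f x = f y) (h : u < v) : f u = f v := by
  have hm : (u + v) / 2 ∈ Ioo u v := ⟨by linarith, by linarith⟩
  have he : EqOn f (fun _ => f ((u + v) / 2)) (closure (Ioo u v)) :=
    EqOn.closure (fun x hx => hc x hx _ hm) hf continuous_const
  rw [closure_Ioo h.ne] at he
  rw [he (left_mem_Icc.2 h.le), he (right_mem_Icc.2 h.le)]

/-- A level set of the Cantor function in `[0, 1]` is compact; its least and greatest elements bound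
the maximal interval of constancy. This replaces maximality by a condition on two values. -/
theorem mem_cantorPlateaus_iff (y : ℝ) :
    y ∈ cantorPlateaus ↔ ∃ u v, IsConstancyInterval cantorFunction u v ∧ y ∈ Icc u v := by
  constructor
  · rintro ⟨u, v, hu, huv, hv, he, hy⟩
    have hK : IsCompact (Icc (0 : ℝ) 1 ∩ cantorFunction ⁻¹' {cantorFunction u}) :=
      isCompact_Icc.inter_right (isClosed_singleton.preimage continuous_cantorFunction)
    have huK : u ∈ Icc (0 : ℝ) 1 ∩ cantorFunction ⁻¹' {cantorFunction u} :=
      ⟨⟨hu, huv.le.trans hv⟩, rfl⟩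
    have hvK : v ∈ Icc (0 : ℝ) 1 ∩ cantorFunction ⁻¹' {cantorFunction u} :=
      ⟨⟨hu.trans huv.le, hv⟩, he.symm⟩
    obtain ⟨p, ⟨hp, hpu⟩, hpl⟩ := hK.exists_isLeast ⟨u, huK⟩
    obtain ⟨q, ⟨hq, hqu⟩, hql⟩ := hK.exists_isGreatest ⟨u, huK⟩
    rw [mem_preimage, mem_singleton_iff] at hpu hqu
    have hc : ∀ x ∈ Ioo p q, cantorFunction x = cantorFunction u := fun x hx =>
      le_antisymm (hqu ▸ cantorFunction_monotone hx.2.le)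
        (hpu ▸ cantorFunction_monotone hx.1.le)
    refine ⟨p, q, ⟨hp.1, ((hpl huK).trans_lt huv).trans_le (hql hvK), hq.2,
      fun x hx y hy => (hc x hx).trans (hc y hy).symm, ?_⟩, (hpl huK).trans hy.1,
      hy.2.trans (hql hvK)⟩
    intro u' v' h0 hup hvq h1 hconst
    have hlt : u' < v' :=
      ((hup.trans (hpl huK)).trans_lt huv).trans_le ((hql hvK).trans hvq)
    have hee := IsConstancyInterval.apply_eq continuous_cantorFunction hconst hlt
    have h5 := cantorFunction_monotone hup
    have h6 := cantorFunction_monotone hvq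
    refine ⟨le_antisymm hup (hpl ⟨⟨h0, hlt.le.trans h1⟩, ?_⟩),
      le_antisymm (hql ⟨⟨h0.trans hlt.le, h1⟩, ?_⟩) hvq⟩ <;>
    · rw [mem_preimage, mem_singleton_iff]
      linarith
  · rintro ⟨u, v, h, hy⟩
    exact ⟨u, v, h.zero_le, h.lt, h.le_one,
      IsConstancyInterval.apply_eq continuous_cantorFunction h.const h.lt, hy⟩

theorem cantorStringSet_eq : cantorStringSet = cantorUnshift ⁻¹' cantorPlateaus := by
  ext x
  simp only [cantorStringSet, mem_iUnion, mem_preimage, mem_cantorPlateaus_iff, exists_prop]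
  refine exists_congr fun u => exists_congr fun v => and_congr_right fun _ => ?_
  constructor
  · rintro ⟨y, hy, rfl⟩
    rwa [cantorUnshift_eq (x := cantorShift y) rfl]
  · intro h
    exact ⟨_, h, cantorUnshift_add x⟩

theorem countable_cantorFunction_plateaus : (cantorFunction '' cantorPlateaus).Countable := by
  refine (cantorFunction_monotone.countable_setOfPred_two_preimages).mono ?_
  rintro _ ⟨y, ⟨u, v, -, huv, -, he, hy⟩, rfl⟩
  have h1 := cantorFunction_monotone hy.1
  have h2 := cantorFunction_monotone hy.2
  exact ⟨u, v, huv, by linarith, by linarith⟩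

/-- By monotonicity the set is a union of full level sets in `[0, 1]`, for countably many values. -/
theorem measurableSet_cantorPlateaus : MeasurableSet cantorPlateaus := by
  have h : cantorPlateaus =
      Icc 0 1 ∩ cantorFunction ⁻¹' (cantorFunction '' cantorPlateaus) := by
    refine Subset.antisymm (fun y hy => ⟨cantorPlateaus_subset hy, y, hy, rfl⟩) ?_
    rintro y ⟨hy, y', ⟨u, v, hu, huv, hv, he, hy'⟩, hyy⟩
    have h1 := cantorFunction_monotone hy'.1
    have h2 := cantorFunction_monotone hy'.2
    rcases lt_or_ge y u with h | h
    · exact ⟨y, v, hy.1, h.trans huv, hv, by linarith, le_rfl, (h.trans huv).le⟩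
    rcases lt_or_ge v y with h' | h'
    · exact ⟨u, y, hu, huv.trans h', hy.2, by linarith, h, le_rfl⟩
    · exact ⟨u, v, hu, huv, hv, he, h, h'⟩
  rw [h]
  exact measurableSet_Icc.inter
    (continuous_cantorFunction.measurable countable_cantorFunction_plateaus.measurableSet)

theorem measurableSet_cantorStringSet : MeasurableSet cantorStringSet := by
  rw [cantorStringSet_eq]
  exact continuous_cantorUnshift.measurable measurableSet_cantorPlateaus

/-- The Cantor set has measure zero. -/
theorem volume_diff_cantorPlateaus : volume (Icc 0 1 \ cantorPlateaus) = 0 := by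
  set N := Icc (0 : ℝ) 1 \ cantorPlateaus with hN
  -- The middle third is a plateau and each outer third of `N` is a copy of `N` scaled by `1/3`, so
  -- `|N| ≤ 2/3 |N|`.
  have hsub : N ⊆ (fun x => 3 * x) ⁻¹' N ∪ (fun x => 3 * x) ⁻¹' ((fun x => x + -2) ⁻¹' N) := by
    rintro y ⟨hy, hyn⟩
    rcases lt_or_ge y (1 / 3) with h | h
    · refine Or.inl ⟨⟨by linarith [hy.1], by linarith⟩, ?_⟩
      rintro ⟨u, v, hu, huv, hv, he, hyu⟩
      refine hyn ⟨u / 3, v / 3, by linarith, by linarith, by linarith, ?_,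
        by linarith [hyu.1], by linarith [hyu.2]⟩
      rw [cantorFunction_left (x := u / 3) (by linarith),
        cantorFunction_left (x := v / 3) (by linarith), show 3 * (u / 3) = u by ring,
        show 3 * (v / 3) = v by ring, he]
    rcases le_or_gt y (2 / 3) with h' | h'
    · refine absurd ⟨1 / 3, 2 / 3, by norm_num, by norm_num, by norm_num, ?_, h, h'⟩ hyn
      rw [cantorFunction_middle, cantorFunction_middle] <;> norm_num
    · refine Or.inr ⟨⟨by simp only; linarith, by linarith [hy.2]⟩, ?_⟩
      rintro ⟨u, v, hu, huv, hv, he, hyu⟩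
      simp only [mem_Icc] at hyu
      refine hyn ⟨(u + 2) / 3, (v + 2) / 3, by linarith, by linarith, by linarith, ?_,
        by linarith [hyu.1], by linarith [hyu.2]⟩
      rw [cantorFunction_right (x := (u + 2) / 3) (by linarith),
        cantorFunction_right (x := (v + 2) / 3) (by linarith),
        show 3 * ((u + 2) / 3) - 2 = u by ring, show 3 * ((v + 2) / 3) - 2 = v by ring, he]
  have hfin : volume N ≠ ⊤ :=
    ne_top_of_le_ne_top (by simp) (measure_mono (sdiff_subset : N ⊆ Icc (0 : ℝ) 1))
  have h1 : volume N ≤ ENNReal.ofReal |3⁻¹| * volume N + ENNReal.ofReal |3⁻¹| * volume N := by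
    refine (measure_mono hsub).trans ((measure_union_le _ _).trans (le_of_eq ?_))
    rw [Real.volume_preimage_mul_left three_ne_zero, Real.volume_preimage_mul_left three_ne_zero,
      measure_preimage_add_right]
  have h2 := ENNReal.toReal_mono (by finiteness) h1
  rw [ENNReal.toReal_add (by finiteness) (by finiteness), ENNReal.toReal_mul,
    ENNReal.toReal_ofReal (abs_nonneg _), abs_of_pos (by norm_num)] at h2
  have h3 : (volume N).toReal = 0 := by
    have := ENNReal.toReal_nonneg (a := volume N)
    linarith
  exact ((ENNReal.toReal_eq_zero_iff _).1 h3).resolve_right hfin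

/-- The 1-Lipschitz map `T⁻¹` sends this part of the string set onto `[0, T⁻¹ x]` up to the null
Cantor set. -/
theorem le_volume_cantorStringSet {x : ℝ} (hx : x ∈ Icc (0 : ℝ) 2) :
    ENNReal.ofReal (cantorUnshift x) ≤ volume (Icc 0 x ∩ cantorStringSet) := by
  refine le_trans ?_ (volume_image_le_of_lipschitzWith_one lipschitzWith_cantorUnshift _)
  have h : Icc 0 (cantorUnshift x) ⊆
      cantorUnshift '' (Icc 0 x ∩ cantorStringSet) ∪ (Icc 0 1 \ cantorPlateaus) := by
    intro y hy
    have hA := cantorUnshift_mem hx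
    by_cases hyp : y ∈ cantorPlateaus
    · have hye : cantorUnshift (cantorShiftIso y) = y := cantorUnshift_eq rfl
      refine Or.inl ⟨cantorShiftIso y, ⟨⟨?_, ?_⟩, ?_⟩, hye⟩
      · rw [cantorShiftIso_apply]
        exact add_nonneg hy.1 (cantorFunction_nonneg y)
      · exact (cantorShiftIso.le_symm_apply).1 hy.2
      · rw [cantorStringSet_eq, mem_preimage, hye]
        exact hyp
    · exact Or.inr ⟨⟨hy.1, hy.2.trans hA.2⟩, hyp⟩
  calc ENNReal.ofReal (cantorUnshift x) = volume (Icc 0 (cantorUnshift x)) := by simp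
    _ ≤ _ := (measure_mono h).trans (measure_union_le _ _)
    _ = _ := by rw [volume_diff_cantorPlateaus, add_zero]

/-- The map `t ↦ t - T⁻¹ t = ξ (T⁻¹ t)` is also 1-Lipschitz, and on the string set it takes only
countably many values. By the intermediate value theorem the rest of `[0, x]` covers almost all of
`[0, x - T⁻¹ x]`. -/
theorem le_volume_diff_cantorStringSet {x : ℝ} (hx : x ∈ Icc (0 : ℝ) 2) :
    ENNReal.ofReal (x - cantorUnshift x) ≤ volume (Icc 0 x \ cantorStringSet) := by
  refine le_trans ?_ (volume_image_le_of_lipschitzWith_one lipschitzWith_sub_cantorUnshift _)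
  have h : Icc 0 (x - cantorUnshift x) ⊆
      (fun t => t - cantorUnshift t) '' (Icc 0 x \ cantorStringSet) ∪
        cantorFunction '' cantorPlateaus := by
    intro c hc
    have hi := intermediate_value_Icc hx.1 (f := fun t => t - cantorUnshift t)
      lipschitzWith_sub_cantorUnshift.continuous.continuousOn
    simp only [cantorUnshift_zero, sub_zero] at hi
    obtain ⟨t, ht, rfl⟩ := hi hc
    by_cases hts : t ∈ cantorStringSet
    · right
      rw [cantorStringSet_eq] at hts
      exact ⟨_, hts, (sub_cantorUnshift t).symm⟩
    · exact Or.inl ⟨t, ⟨ht, hts⟩, rfl⟩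
  calc ENNReal.ofReal (x - cantorUnshift x) = volume (Icc 0 (x - cantorUnshift x)) := by simp
    _ ≤ _ := (measure_mono h).trans (measure_union_le _ _)
    _ = _ := by rw [countable_cantorFunction_plateaus.measure_zero, add_zero]

/-- The two lower bounds already add up to `x`, so both are equalities. -/
theorem volume_real_Icc_inter_cantorStringSet {x : ℝ} (hx : x ∈ Icc (0 : ℝ) 2) :
    volume.real (Icc 0 x ∩ cantorStringSet) = cantorUnshift x ∧
      volume.real (Icc 0 x \ cantorStringSet) = x - cantorUnshift x := by
  have hA := cantorUnshift_mem hx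
  have hB : 0 ≤ x - cantorUnshift x := by
    rw [sub_cantorUnshift]; exact cantorFunction_nonneg _
  have hfin : volume (Icc 0 x) ≠ ⊤ := by simp
  have h1 := ENNReal.toReal_mono
    (ne_top_of_le_ne_top hfin (measure_mono inter_subset_left)) (le_volume_cantorStringSet hx)
  have h2 := ENNReal.toReal_mono
    (ne_top_of_le_ne_top hfin (measure_mono sdiff_subset)) (le_volume_diff_cantorStringSet hx)
  rw [ENNReal.toReal_ofReal hA.1] at h1
  rw [ENNReal.toReal_ofReal hB] at h2
  have h3 := measureReal_inter_add_sdiff (μ := volume) (s := Icc 0 x)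
    measurableSet_cantorStringSet hfin
  rw [Real.volume_real_Icc_of_le hx.1] at h3
  simp only [measureReal_def] at *
  constructor <;> linarith

theorem volume_Ioc_inter_of_volume_real_Icc {E : Set ℝ} {f : ℝ → ℝ} {L : ℝ}
    (hE : MeasurableSet E) (h : ∀ x ∈ Icc 0 L, volume.real (Icc 0 x ∩ E) = f x) {a b : ℝ}
    (ha : 0 ≤ a) (hab : a ≤ b) (hb : b ≤ L) :
    volume (Ioc a b ∩ E) = ENNReal.ofReal (f b - f a) := by
  have hd : Disjoint (Icc 0 a ∩ E) (Ioc a b ∩ E) := by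
    refine Disjoint.mono inter_subset_left inter_subset_left ?_
    exact disjoint_left.2 fun t ht ht' => not_lt_of_ge ht.2 ht'.1
  have hfin : volume (Ioc a b ∩ E) ≠ ⊤ :=
    ne_top_of_le_ne_top (by simp) (measure_mono inter_subset_left : _ ≤ volume (Ioc a b))
  have hfin' : volume (Icc 0 a ∩ E) ≠ ⊤ :=
    ne_top_of_le_ne_top (by simp) (measure_mono inter_subset_left : _ ≤ volume (Icc 0 a))
  have hu := measureReal_union (μ := volume) hd (measurableSet_Ioc.inter hE) hfin' hfin
  rw [← union_inter_distrib_right, Icc_union_Ioc_eq_Icc ha hab, h b ⟨ha.trans hab, hb⟩,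
    h a ⟨ha, hab.trans hb⟩] at hu
  rw [hu, add_sub_cancel_left, measureReal_def, ENNReal.ofReal_toReal hfin]

theorem volume_Ioc_inter_cantorStringSet {a b : ℝ} (ha : 0 ≤ a) (hab : a ≤ b) (hb : b ≤ 2) :
    volume (Ioc a b ∩ cantorStringSet) =
      ENNReal.ofReal (cantorUnshift b - cantorUnshift a) :=
  volume_Ioc_inter_of_volume_real_Icc measurableSet_cantorStringSet
    (fun _ hx => (volume_real_Icc_inter_cantorStringSet hx).1) ha hab hb

theorem volume_Ioc_inter_compl_cantorStringSet {a b : ℝ} (ha : 0 ≤ a) (hab : a ≤ b)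
    (hb : b ≤ 2) :
    volume (Ioc a b ∩ cantorStringSetᶜ) =
      ENNReal.ofReal (cantorFunction (cantorUnshift b) - cantorFunction (cantorUnshift a)) := by
  have := volume_Ioc_inter_of_volume_real_Icc measurableSet_cantorStringSet.compl
    (fun _ hx => (volume_real_Icc_inter_cantorStringSet hx).2) ha hab hb
  rwa [sub_cantorUnshift, sub_cantorUnshift] at this

/-! ### The string equation: linearity and uniqueness -/

theorem isLocallyFiniteMeasure_of_le_volume {μ : Measure ℝ} (h : μ ≤ volume) :
    IsLocallyFiniteMeasure μ :=
  ⟨fun x => (Measure.finiteAt_nhds volume x).mono le_rfl h⟩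

theorem nullSingletonClass_of_le_volume {μ : Measure ℝ} (h : μ ≤ volume) : NullSingletonClass μ :=
  ⟨fun x => le_antisymm ((h {x}).trans (by simp)) zero_le⟩

/-- One Picard step: domination by Lebesgue measure preserves the factorial gain of the classical
case. -/
theorem intervalIntegral_pow_factorial_bound {μ : Measure ℝ} (hμ : μ ≤ volume) {f : ℝ → ℂ}
    {K r x : ℝ} {n : ℕ} (hK : 0 ≤ K) (hr : 0 ≤ r) (hx : 0 ≤ x)
    (hf : ∀ t ∈ Icc 0 x, ‖f t‖ ≤ K * (r ^ n * t ^ n / n.factorial)) :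
    ‖∫ t in (0 : ℝ)..x, f t ∂μ‖ ≤ K * (r ^ n * x ^ (n + 1) / (n + 1).factorial) := by
  have := isLocallyFiniteMeasure_of_le_volume hμ
  have hc : Continuous fun t : ℝ => K * (r ^ n * t ^ n / n.factorial) := by fun_prop
  calc ‖∫ t in (0 : ℝ)..x, f t ∂μ‖
      ≤ ∫ t in (0 : ℝ)..x, K * (r ^ n * t ^ n / n.factorial) ∂μ :=
        intervalIntegral.norm_integral_le_of_norm_le hx
          (Eventually.of_forall fun t ht => hf t ⟨ht.1.le, ht.2⟩) (hc.intervalIntegrable _ _)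
    _ ≤ ∫ t in (0 : ℝ)..x, K * (r ^ n * t ^ n / n.factorial) := by
        rw [intervalIntegral.integral_of_le hx, intervalIntegral.integral_of_le hx]
        refine integral_mono_measure (Measure.restrict_mono le_rfl hμ) ?_
          (hc.integrableOn_Icc.mono_set Ioc_subset_Icc_self)
        filter_upwards [ae_restrict_mem measurableSet_Ioc] with t ht
        have := ht.1.le
        simp only [Pi.zero_apply]
        positivity
    _ = K * (r ^ n * x ^ (n + 1) / (n + 1).factorial) := by
        simp only [mul_div_assoc, intervalIntegral.integral_const_mul,
          intervalIntegral.integral_div, integral_pow, Nat.factorial_succ]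
        push_cast
        field_simp
        simp

/-- `(u, v)` solves `du = v dβ`, `dv = w u dα` on `[0, 2]`. -/
structure IsStringSolution (α β : Measure ℝ) (w : ℂ) (u v : ℝ → ℂ) : Prop where
  continuousOn_fst : ContinuousOn u (Icc 0 2)
  continuousOn_snd : ContinuousOn v (Icc 0 2)
  fst_eq : ∀ x ∈ Icc (0 : ℝ) 2, u x = u 0 + ∫ t in (0 : ℝ)..x, v t ∂β
  snd_eq : ∀ x ∈ Icc (0 : ℝ) 2, v x = v 0 + w * ∫ t in (0 : ℝ)..x, u t ∂α

theorem ContinuousOn.intervalIntegrable_of_le_volume {μ : Measure ℝ} (hμ : μ ≤ volume)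
    {f : ℝ → ℂ} (hf : ContinuousOn f (Icc 0 2)) {a b : ℝ} (ha : a ∈ Icc (0 : ℝ) 2)
    (hb : b ∈ Icc (0 : ℝ) 2) : IntervalIntegrable f μ a b := by
  have := isLocallyFiniteMeasure_of_le_volume hμ
  exact (hf.mono ((convex_Icc (0 : ℝ) 2).ordConnected.uIcc_subset ha hb)).intervalIntegrable

namespace IsStringSolution

variable {α β : Measure ℝ} {w : ℂ} {u v u₁ v₁ u₂ v₂ : ℝ → ℂ}

theorem linearCombination (hα : α ≤ volume) (hβ : β ≤ volume)
    (h₁ : IsStringSolution α β w u₁ v₁) (h₂ : IsStringSolution α β w u₂ v₂) (c d : ℂ) :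
    IsStringSolution α β w (fun x => c * u₁ x + d * u₂ x) (fun x => c * v₁ x + d * v₂ x) := by
  have h0 : (0 : ℝ) ∈ Icc (0 : ℝ) 2 := by simp
  refine ⟨(continuousOn_const.mul h₁.1).add (continuousOn_const.mul h₂.1),
    (continuousOn_const.mul h₁.2).add (continuousOn_const.mul h₂.2), fun x hx => ?_,
    fun x hx => ?_⟩
  · rw [intervalIntegral.integral_add
      ((h₁.2.intervalIntegrable_of_le_volume hβ h0 hx).const_mul _)
      ((h₂.2.intervalIntegrable_of_le_volume hβ h0 hx).const_mul _),
      intervalIntegral.integral_const_mul, intervalIntegral.integral_const_mul, h₁.3 x hx,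
      h₂.3 x hx]
    ring
  · rw [intervalIntegral.integral_add
      ((h₁.1.intervalIntegrable_of_le_volume hα h0 hx).const_mul _)
      ((h₂.1.intervalIntegrable_of_le_volume hα h0 hx).const_mul _),
      intervalIntegral.integral_const_mul, intervalIntegral.integral_const_mul, h₁.4 x hx,
      h₂.4 x hx]
    ring

/-- Iterating the integral equations bounds both components by `K (r x) ^ n / n!`, which tends to 0.
Taking `r ≥ 1` covers the first equation, which has no factor `w`. -/
theorem eq_zero (hα : α ≤ volume) (hβ : β ≤ volume) (h : IsStringSolution α β w u v)
    (hu : u 0 = 0) (hv : v 0 = 0) : ∀ x ∈ Icc (0 : ℝ) 2, u x = 0 ∧ v x = 0 := by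
  obtain ⟨K₁, hK₁⟩ := isCompact_Icc.exists_bound_of_continuousOn h.1
  obtain ⟨K₂, hK₂⟩ := isCompact_Icc.exists_bound_of_continuousOn h.2
  set K := max K₁ K₂
  set r := max 1 ‖w‖
  have h0 : (0 : ℝ) ∈ Icc (0 : ℝ) 2 := by simp
  have hK : 0 ≤ K := ((norm_nonneg _).trans (hK₁ 0 h0)).trans (le_max_left _ _)
  have hr1 : 1 ≤ r := le_max_left _ _
  have hr : 0 ≤ r := zero_le_one.trans hr1
  have key : ∀ n : ℕ, ∀ x ∈ Icc (0 : ℝ) 2, ‖u x‖ ≤ K * (r ^ n * x ^ n / n.factorial) ∧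
      ‖v x‖ ≤ K * (r ^ n * x ^ n / n.factorial) := by
    intro n
    induction n with
    | zero =>
      intro x hx
      simpa using ⟨(hK₁ x hx).trans (le_max_left _ _), (hK₂ x hx).trans (le_max_right _ _)⟩
    | succ n ih =>
      intro x hx
      have hsub : ∀ t ∈ Icc 0 x, t ∈ Icc (0 : ℝ) 2 := fun t ht => ⟨ht.1, ht.2.trans hx.2⟩
      have h1 := intervalIntegral_pow_factorial_bound hβ hK hr hx.1
        fun t ht => (ih t (hsub t ht)).2
      have h2 := intervalIntegral_pow_factorial_bound hα hK hr hx.1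
        fun t ht => (ih t (hsub t ht)).1
      set Z := K * (r ^ n * x ^ (n + 1) / (n + 1).factorial) with hZ
      have hZ0 : 0 ≤ Z := (norm_nonneg _).trans h1
      have hZr : K * (r ^ (n + 1) * x ^ (n + 1) / (n + 1).factorial) = r * Z := by
        rw [hZ]; ring
      rw [hZr, h.3 x hx, h.4 x hx, hu, hv, zero_add, zero_add, norm_mul]
      exact ⟨h1.trans (le_mul_of_one_le_left hZ0 hr1),
        mul_le_mul (le_max_right _ _) h2 (norm_nonneg _) hr⟩
  intro x hx
  have hlim : Tendsto (fun n : ℕ => K * (r ^ n * x ^ n / n.factorial)) atTop (nhds 0) := by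
    simp only [← mul_pow]
    simpa using (FloorSemiring.tendsto_pow_div_factorial_atTop (r * x)).const_mul K
  exact ⟨norm_le_zero_iff.1 (ge_of_tendsto' hlim fun n => (key n x hx).1),
    norm_le_zero_iff.1 (ge_of_tendsto' hlim fun n => (key n x hx).2)⟩

end IsStringSolution

/-! ### Solutions as power series in the spectral parameter -/

/-- The coefficients of the power series in `w` of the solution of `du = v dβ`, `dv = w u dα` with
initial value `(c, d)`. -/
noncomputable def stringCoeff (α β : Measure ℝ) (c d : ℝ) : ℕ → (ℝ → ℝ) × (ℝ → ℝ)
  | 0 => (fun x => c + ∫ _ in (0 : ℝ)..x, d ∂β, fun _ => d)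
  | n + 1 =>
    (fun x => ∫ s in (0 : ℝ)..x, ∫ t in (0 : ℝ)..s, (stringCoeff α β c d n).1 t ∂α ∂β,
      fun x => ∫ t in (0 : ℝ)..x, (stringCoeff α β c d n).1 t ∂α)

section Series

variable {α β : Measure ℝ} (hα : α ≤ volume) (hβ : β ≤ volume)
include hα hβ

theorem continuous_stringCoeff (c d : ℝ) (n : ℕ) :
    Continuous (stringCoeff α β c d n).1 ∧ Continuous (stringCoeff α β c d n).2 := by
  have := isLocallyFiniteMeasure_of_le_volume hα
  have := isLocallyFiniteMeasure_of_le_volume hβ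
  have := nullSingletonClass_of_le_volume hα
  have := nullSingletonClass_of_le_volume hβ
  induction n with
  | zero =>
    exact ⟨continuous_const.add (intervalIntegral.continuous_primitive
      (fun _ _ => continuous_const.intervalIntegrable _ _) 0), continuous_const⟩
  | succ n ih =>
    have h := intervalIntegral.continuous_primitive (μ := α)
      (fun a b => ih.1.intervalIntegrable a b) 0
    exact ⟨intervalIntegral.continuous_primitive (fun a b => h.intervalIntegrable a b) 0, h⟩

omit hα hβ in
theorem stringCoeff_nonneg {c d : ℝ} (hc : 0 ≤ c) (hd : 0 ≤ d) (n : ℕ) {x : ℝ} (hx : 0 ≤ x) :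
    0 ≤ (stringCoeff α β c d n).1 x ∧ 0 ≤ (stringCoeff α β c d n).2 x := by
  induction n generalizing x with
  | zero =>
    exact ⟨add_nonneg hc (intervalIntegral.integral_nonneg hx fun _ _ => hd), hd⟩
  | succ n ih =>
    have h : ∀ s, 0 ≤ s → 0 ≤ ∫ t in (0 : ℝ)..s, (stringCoeff α β c d n).1 t ∂α := fun s hs =>
      intervalIntegral.integral_nonneg hs fun t ht => (ih ht.1).1
    exact ⟨intervalIntegral.integral_nonneg hx fun s hs => h s hs.1, h x hx⟩

/-- The `α`-integration supplies the factorial; the `β`-integration is bounded crudely by a factor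
2, the length of the interval. This suffices for convergence at every `w`. -/
theorem stringCoeff_le {c d : ℝ} (hc : 0 ≤ c) (hd : 0 ≤ d) (n : ℕ) {x : ℝ}
    (hx : x ∈ Icc (0 : ℝ) 2) :
    (stringCoeff α β c d n).1 x ≤ (c + 2 * d) * (2 ^ n * x ^ n / n.factorial) ∧
      (stringCoeff α β c d n).2 x ≤ (c + 2 * d) * (2 ^ n * x ^ n / n.factorial) := by
  have hK : 0 ≤ c + 2 * d := by positivity
  induction n generalizing x with
  | zero =>
    have h := intervalIntegral_pow_factorial_bound hβ (f := fun _ => (d : ℂ)) (r := 0) (n := 0)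
      hd le_rfl hx.1 (fun t _ => by simp [abs_of_nonneg hd])
    rw [intervalIntegral.integral_ofReal, Complex.norm_real] at h
    have h' := (le_abs_self _).trans h
    have hx2 := mul_le_mul_of_nonneg_left hx.2 hd
    simp only [stringCoeff]
    norm_num at h' ⊢
    constructor <;> linarith
  | succ n ih =>
    have h1 : ∀ s ∈ Icc (0 : ℝ) 2, (stringCoeff α β c d (n + 1)).2 s ≤
        (c + 2 * d) * (2 ^ n * s ^ (n + 1) / (n + 1).factorial) := by
      intro s hs
      have h := intervalIntegral_pow_factorial_bound hα
        (f := fun t => ((stringCoeff α β c d n).1 t : ℂ)) (x := s) hK zero_le_two hs.1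
        fun t ht => by
          rw [Complex.norm_real, Real.norm_of_nonneg (stringCoeff_nonneg hc hd n ht.1).1]
          exact (ih ⟨ht.1, ht.2.trans hs.2⟩).1
      rw [intervalIntegral.integral_ofReal, Complex.norm_real] at h
      exact (le_abs_self _).trans h
    have h2 : (stringCoeff α β c d (n + 1)).1 x ≤
        (c + 2 * d) * (2 ^ n * x ^ (n + 1) / (n + 1).factorial) * x := by
      have h := intervalIntegral_pow_factorial_bound hβ (r := 0) (n := 0)
        (f := fun t => ((stringCoeff α β c d (n + 1)).2 t : ℂ)) (x := x)
        (K := (c + 2 * d) * (2 ^ n * x ^ (n + 1) / (n + 1).factorial))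
        (mul_nonneg hK (by have := hx.1; positivity)) le_rfl hx.1
        fun t ht => by
          rw [Complex.norm_real, Real.norm_of_nonneg (stringCoeff_nonneg hc hd (n + 1) ht.1).2]
          refine (h1 t ⟨ht.1, ht.2.trans hx.2⟩).trans ?_
          have := ht.1
          have := ht.2
          simp only [pow_zero, Nat.factorial_zero, Nat.cast_one, mul_one, div_one]
          gcongr
      rw [intervalIntegral.integral_ofReal, Complex.norm_real] at h
      refine ((le_abs_self _).trans h).trans (le_of_eq ?_)
      simp
    have hp : 0 ≤ (c + 2 * d) * (2 ^ n * x ^ (n + 1) / (n + 1).factorial) :=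
      mul_nonneg hK (by have := hx.1; positivity)
    have he : (c + 2 * d) * (2 ^ (n + 1) * x ^ (n + 1) / (n + 1).factorial) =
        (c + 2 * d) * (2 ^ n * x ^ (n + 1) / (n + 1).factorial) * 2 := by ring
    rw [he]
    refine ⟨h2.trans (mul_le_mul_of_nonneg_left hx.2 hp), (h1 x hx).trans ?_⟩
    linarith

end Series

theorem summable_pow_mul_pow_factorial (K r : ℝ) :
    Summable fun n : ℕ => r ^ n * (K * (4 ^ n / n.factorial)) := by
  refine ((Real.summable_pow_div_factorial (r * 4)).mul_left K).congr fun n => ?_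
  rw [mul_pow]; ring

/-- The first component of the solution of `du = v dβ`, `dv = w u dα` with initial value
`(c, d)`. -/
noncomputable def stringFst (α β : Measure ℝ) (c d : ℝ) (w : ℂ) (x : ℝ) : ℂ :=
  ∑' n : ℕ, w ^ n * ((stringCoeff α β c d n).1 x : ℂ)

/-- The second component of the solution of `du = v dβ`, `dv = w u dα` with initial value
`(c, d)`. -/
noncomputable def stringSnd (α β : Measure ℝ) (c d : ℝ) (w : ℂ) (x : ℝ) : ℂ :=
  ∑' n : ℕ, w ^ n * ((stringCoeff α β c d n).2 x : ℂ)

section Series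

variable {α β : Measure ℝ} (hα : α ≤ volume) (hβ : β ≤ volume) {c d : ℝ} (hc : 0 ≤ c)
  (hd : 0 ≤ d)
include hα hβ hc hd

theorem norm_stringCoeff_le (w : ℂ) (n : ℕ) {x : ℝ} (hx : x ∈ Icc (0 : ℝ) 2) :
    ‖w ^ n * ((stringCoeff α β c d n).1 x : ℂ)‖ ≤
        ‖w‖ ^ n * ((c + 2 * d) * (4 ^ n / n.factorial)) ∧
      ‖w ^ n * ((stringCoeff α β c d n).2 x : ℂ)‖ ≤
        ‖w‖ ^ n * ((c + 2 * d) * (4 ^ n / n.factorial)) := by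
  have h := stringCoeff_le hα hβ hc hd n hx
  have h0 := stringCoeff_nonneg (α := α) (β := β) hc hd n hx.1
  have hb : (c + 2 * d) * (2 ^ n * x ^ n / n.factorial) ≤
      (c + 2 * d) * (4 ^ n / n.factorial) := by
    have h4 : (4 : ℝ) ^ n = 2 ^ n * 2 ^ n := by rw [← mul_pow]; norm_num
    have := hx.1
    have := hx.2
    rw [h4]
    gcongr
  rw [norm_mul, norm_mul, norm_pow, Complex.norm_real, Complex.norm_real,
    Real.norm_of_nonneg h0.1, Real.norm_of_nonneg h0.2]
  exact ⟨mul_le_mul_of_nonneg_left (h.1.trans hb) (by positivity),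
    mul_le_mul_of_nonneg_left (h.2.trans hb) (by positivity)⟩

theorem hasSum_stringFst (w : ℂ) {x : ℝ} (hx : x ∈ Icc (0 : ℝ) 2) :
    HasSum (fun n : ℕ => w ^ n * ((stringCoeff α β c d n).1 x : ℂ)) (stringFst α β c d w x) :=
  (Summable.of_norm_bounded (summable_pow_mul_pow_factorial (c + 2 * d) ‖w‖)
    fun n => (norm_stringCoeff_le hα hβ hc hd w n hx).1).hasSum

theorem hasSum_stringSnd (w : ℂ) {x : ℝ} (hx : x ∈ Icc (0 : ℝ) 2) :
    HasSum (fun n : ℕ => w ^ n * ((stringCoeff α β c d n).2 x : ℂ)) (stringSnd α β c d w x) :=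
  (Summable.of_norm_bounded (summable_pow_mul_pow_factorial (c + 2 * d) ‖w‖)
    fun n => (norm_stringCoeff_le hα hβ hc hd w n hx).2).hasSum

omit hα hβ hc hd in
theorem hasSum_integral_of_bound {μ : Measure ℝ} (hμ : μ ≤ volume) {F : ℕ → ℝ → ℂ} {f : ℝ → ℂ}
    {b : ℕ → ℝ} (hb : Summable b) (hF : ∀ n, Continuous (F n))
    (hFb : ∀ n, ∀ t ∈ Icc (0 : ℝ) 2, ‖F n t‖ ≤ b n)
    (hf : ∀ t ∈ Icc (0 : ℝ) 2, HasSum (fun n => F n t) (f t)) {x : ℝ}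
    (hx : x ∈ Icc (0 : ℝ) 2) :
    HasSum (fun n => ∫ t in (0 : ℝ)..x, F n t ∂μ) (∫ t in (0 : ℝ)..x, f t ∂μ) := by
  have := isLocallyFiniteMeasure_of_le_volume hμ
  have hsub : ∀ t ∈ uIoc 0 x, t ∈ Icc (0 : ℝ) 2 := by
    intro t ht
    rw [uIoc_of_le hx.1] at ht
    exact ⟨ht.1.le, ht.2.trans hx.2⟩
  exact intervalIntegral.hasSum_integral_of_dominated_convergence (fun n _ => b n)
    (fun n => (hF n).aestronglyMeasurable)
    (fun n => Eventually.of_forall fun t ht => hFb n t (hsub t ht))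
    (Eventually.of_forall fun _ _ => hb) (continuous_const.intervalIntegrable _ _)
    (Eventually.of_forall fun t ht => hf t (hsub t ht))

omit hα hβ hc hd in
theorem stringFst_zero (w : ℂ) : stringFst α β c d w 0 = c := by
  rw [stringFst, tsum_eq_single 0]
  · simp [stringCoeff]
  · intro n hn
    obtain ⟨n, rfl⟩ := Nat.exists_eq_succ_of_ne_zero hn
    simp [stringCoeff]

omit hα hβ hc hd in
theorem stringSnd_zero (w : ℂ) : stringSnd α β c d w 0 = d := by
  rw [stringSnd, tsum_eq_single 0]
  · simp [stringCoeff]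
  · intro n hn
    obtain ⟨n, rfl⟩ := Nat.exists_eq_succ_of_ne_zero hn
    simp [stringCoeff]

/-- Termwise integration. The `u`-coefficient of order `n` comes from the `v`-coefficient of the
same order, while the `v`-coefficient of order `n + 1` comes from the `u`-coefficient of order `n`.
-/
theorem isStringSolution_string (w : ℂ) :
    IsStringSolution α β w (stringFst α β c d w) (stringSnd α β c d w) := by
  have hb := summable_pow_mul_pow_factorial (c + 2 * d) ‖w‖
  have hcont := fun n => continuous_stringCoeff hα hβ c d n
  have hcu : ∀ n, Continuous fun x => w ^ n * ((stringCoeff α β c d n).1 x : ℂ) := fun n =>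
    continuous_const.mul (Complex.continuous_ofReal.comp (hcont n).1)
  have hcv : ∀ n, Continuous fun x => w ^ n * ((stringCoeff α β c d n).2 x : ℂ) := fun n =>
    continuous_const.mul (Complex.continuous_ofReal.comp (hcont n).2)
  refine ⟨continuousOn_tsum (fun n => (hcu n).continuousOn) hb
    fun n x hx => (norm_stringCoeff_le hα hβ hc hd w n hx).1,
    continuousOn_tsum (fun n => (hcv n).continuousOn) hb
    fun n x hx => (norm_stringCoeff_le hα hβ hc hd w n hx).2, fun x hx => ?_, fun x hx => ?_⟩
  · have h1 := hasSum_integral_of_bound hβ hb hcv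
      (fun n t ht => (norm_stringCoeff_le hα hβ hc hd w n ht).2)
      (fun t ht => hasSum_stringSnd hα hβ hc hd w ht) hx
    have h2 := hasSum_stringFst hα hβ hc hd w hx
    have h3 := (hasSum_nat_add_iff' 1).2 h1
    have h4 := (hasSum_nat_add_iff' 1).2 h2
    have h5 := h4.unique (h3.congr_fun fun n => ?_)
    · rw [stringFst_zero]
      simp only [Finset.sum_range_one, pow_zero, one_mul, stringCoeff,
        intervalIntegral.integral_ofReal, Complex.ofReal_add] at h5
      linear_combination h5
    · rw [intervalIntegral.integral_const_mul, intervalIntegral.integral_ofReal]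
      rfl
  · have h1 := (hasSum_integral_of_bound hα hb hcu
      (fun n t ht => (norm_stringCoeff_le hα hβ hc hd w n ht).1)
      (fun t ht => hasSum_stringFst hα hβ hc hd w ht) hx).mul_left w
    have h2 := (hasSum_nat_add_iff' 1).2 (hasSum_stringSnd hα hβ hc hd w hx)
    have h3 := h2.unique (h1.congr_fun fun n => ?_)
    · rw [stringSnd_zero]
      simp only [Finset.sum_range_one, pow_zero, one_mul, stringCoeff] at h3
      linear_combination h3
    · rw [intervalIntegral.integral_const_mul, intervalIntegral.integral_ofReal, pow_succ',
        mul_assoc]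
      rfl

/-- The Taylor coefficients in `w` are nonnegative, so on a disc the maximum modulus is attained at
the positive radius. -/
theorem norm_string_le (w : ℂ) {x r : ℝ} (hx : x ∈ Icc (0 : ℝ) 2) (hw : ‖w‖ ≤ r) :
    ‖stringFst α β c d w x‖ ≤ ‖stringFst α β c d r x‖ ∧
      ‖stringSnd α β c d w x‖ ≤ ‖stringSnd α β c d r x‖ := by
  have hr : 0 ≤ r := (norm_nonneg w).trans hw
  have key : ∀ {f : ℕ → ℝ} {a b : ℂ}, (∀ n, 0 ≤ f n) →
      HasSum (fun n => w ^ n * (f n : ℂ)) a → HasSum (fun n => (r : ℂ) ^ n * (f n : ℂ)) b →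
      ‖a‖ ≤ ‖b‖ := by
    intro f a b hf ha hb
    have hb' := Complex.hasSum_re hb
    have he : ∀ n, ((r : ℂ) ^ n * (f n : ℂ)).re = r ^ n * f n := fun n => by
      rw [← Complex.ofReal_pow, ← Complex.ofReal_mul, Complex.ofReal_re]
    simp only [he] at hb'
    rw [← ha.tsum_eq]
    refine (tsum_of_norm_bounded hb' fun n => ?_).trans (Complex.re_le_norm b)
    rw [norm_mul, norm_pow, Complex.norm_real, Real.norm_of_nonneg (hf n)]
    exact mul_le_mul_of_nonneg_right (pow_le_pow_left₀ (norm_nonneg _) hw n) (hf n)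
  exact ⟨key (fun n => (stringCoeff_nonneg hc hd n hx.1).1) (hasSum_stringFst hα hβ hc hd w hx)
      (hasSum_stringFst hα hβ hc hd r hx),
    key (fun n => (stringCoeff_nonneg hc hd n hx.1).2) (hasSum_stringSnd hα hβ hc hd w hx)
      (hasSum_stringSnd hα hβ hc hd r hx)⟩

/-- For a nonnegative spectral parameter, the solution is real and dominates its coefficients. -/
theorem string_ofReal {r x : ℝ} (hr : 0 ≤ r) (hx : x ∈ Icc (0 : ℝ) 2) :
    (∃ y : ℝ, stringFst α β c d r x = y ∧ (stringCoeff α β c d 0).1 x ≤ y) ∧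
      ∃ y : ℝ, stringSnd α β c d r x = y ∧ (stringCoeff α β c d 0).2 x ≤ y := by
  have key : ∀ {f : ℕ → ℝ} {b : ℂ}, (∀ n, 0 ≤ f n) →
      HasSum (fun n => (r : ℂ) ^ n * (f n : ℂ)) b → ∃ y : ℝ, b = y ∧ f 0 ≤ y := by
    intro f b hf hb
    have he : ∀ n, (r : ℂ) ^ n * (f n : ℂ) = ((r ^ n * f n : ℝ) : ℂ) := fun n => by
      push_cast; rfl
    simp only [he] at hb
    have hs : Summable fun n => r ^ n * f n := Complex.summable_ofReal.1 hb.summable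
    refine ⟨∑' n, r ^ n * f n, hb.unique (Complex.hasSum_ofReal.2 hs.hasSum), ?_⟩
    simpa using hs.le_tsum 0 fun n _ => mul_nonneg (pow_nonneg hr n) (hf n)
  exact ⟨key (fun n => (stringCoeff_nonneg hc hd n hx.1).1) (hasSum_stringFst hα hβ hc hd r hx),
    key (fun n => (stringCoeff_nonneg hc hd n hx.1).2) (hasSum_stringSnd hα hβ hc hd r hx)⟩

end Series

theorem IsStringSolution.eq_linearCombination {α β : Measure ℝ} (hα : α ≤ volume)
    (hβ : β ≤ volume) {w : ℂ} {u v : ℝ → ℂ} (h : IsStringSolution α β w u v) {x : ℝ}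
    (hx : x ∈ Icc (0 : ℝ) 2) :
    u x = u 0 * stringFst α β 1 0 w x + v 0 * stringFst α β 0 1 w x ∧
      v x = u 0 * stringSnd α β 1 0 w x + v 0 * stringSnd α β 0 1 w x := by
  have h1 := isStringSolution_string hα hβ zero_le_one le_rfl w
  have h2 := isStringSolution_string hα hβ le_rfl zero_le_one w
  have h3 := h.linearCombination hα hβ (h1.linearCombination hα hβ h2 (u 0) (v 0)) 1 (-1)
  have h4 := h3.eq_zero hα hβ (by simp [stringFst_zero]) (by simp [stringSnd_zero]) x hx
  exact ⟨by linear_combination h4.1, by linear_combination h4.2⟩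

/-! ### Self-similarity of the mass and length measures -/

theorem restrict_Ioc_eq_of_forall_Ioc {μ ν : Measure ℝ} [IsLocallyFiniteMeasure μ] {p q : ℝ}
    (h : ∀ a b, p ≤ a → a ≤ b → b ≤ q → μ (Ioc a b) = ν (Ioc a b)) :
    μ.restrict (Ioc p q) = ν.restrict (Ioc p q) := by
  refine Measure.ext_of_Ioc _ _ fun a b _ => ?_
  rw [Measure.restrict_apply measurableSet_Ioc, Measure.restrict_apply measurableSet_Ioc,
    Ioc_inter_Ioc]
  rcases le_total (max a p) (min b q) with h' | h'
  · exact h _ _ (le_max_right _ _) h' (min_le_right _ _)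
  · simp [Ioc_eq_empty_of_le h']

/-- Half-open intervals determine the measure, so the scaling assumed on them identifies `μ` with
`k` times its push-forward along `e` on the image interval. -/
theorem intervalIntegral_comp_orderIso {μ : Measure ℝ} [IsLocallyFiniteMeasure μ] (e : ℝ ≃o ℝ)
    {k L : ℝ} (hk : 0 ≤ k)
    (h : ∀ a b, 0 ≤ a → a ≤ b → b ≤ L → μ (Ioc (e a) (e b)) = ENNReal.ofReal k * μ (Ioc a b))
    (f : ℝ → ℂ) {x : ℝ} (hx : x ∈ Icc 0 L) :
    ∫ t in (e 0)..(e x), f t ∂μ = k * ∫ t in (0 : ℝ)..x, f (e t) ∂μ := by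
  have hpre : ∀ a b, e ⁻¹' Ioc (e a) (e b) = Ioc a b := fun a b => by ext t; simp
  have hr : μ.restrict (Ioc (e 0) (e x)) =
      (ENNReal.ofReal k • μ.map e.toHomeomorph.toMeasurableEquiv).restrict
        (Ioc (e 0) (e x)) := by
    refine restrict_Ioc_eq_of_forall_Ioc fun a b ha hab hb => ?_
    obtain ⟨a, rfl⟩ := e.surjective a
    obtain ⟨b, rfl⟩ := e.surjective b
    rw [e.le_iff_le] at ha hab hb
    rw [h a b ha hab (hb.trans hx.2), Measure.smul_apply, MeasurableEquiv.map_apply,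
      smul_eq_mul]
    exact congrArg (fun s => ENNReal.ofReal k * μ s) (hpre a b).symm
  rw [intervalIntegral.integral_of_le (e.monotone hx.1), hr, Measure.restrict_smul,
    integral_smul_measure, setIntegral_map_equiv, intervalIntegral.integral_of_le hx.1,
    ENNReal.toReal_ofReal hk, Complex.real_smul]
  congr 1
  exact congrArg (fun s => ∫ t in s, f (e t) ∂μ) (hpre 0 x)

/-- The self-similarity `T ∘ (y ↦ (y + j) / 3) ∘ T⁻¹` of the Cantor string. -/
noncomputable def cantorSelfMap (j : ℝ) : ℝ ≃o ℝ :=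
  cantorShiftIso.symm.trans (((OrderIso.addRight j).trans
    (OrderIso.divRight₀ 3 three_pos)).trans cantorShiftIso)

theorem cantorUnshift_selfMap (j x : ℝ) :
    cantorUnshift (cantorSelfMap j x) = (cantorUnshift x + j) / 3 :=
  cantorShiftIso.symm_apply_apply _

theorem cantorSelfMap_eq {j x y : ℝ} (h : (cantorUnshift x + j) / 3 = y) :
    cantorSelfMap j x = y + cantorFunction y := by
  rw [← h]; rfl

theorem cantorSelfMap_zero_zero : cantorSelfMap 0 0 = 0 := by
  rw [cantorSelfMap_eq (y := 0) (by rw [cantorUnshift_zero]; norm_num),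
    cantorFunction_of_nonpos le_rfl, add_zero]

theorem cantorSelfMap_zero_two : cantorSelfMap 0 2 = 5 / 6 := by
  rw [cantorSelfMap_eq (y := 1 / 3) (by rw [cantorUnshift_two]; norm_num),
    cantorFunction_middle le_rfl (by norm_num)]
  norm_num

theorem cantorSelfMap_two_zero : cantorSelfMap 2 0 = 7 / 6 := by
  rw [cantorSelfMap_eq (y := 2 / 3) (by rw [cantorUnshift_zero]; norm_num),
    cantorFunction_middle (by norm_num) le_rfl]
  norm_num

theorem cantorSelfMap_two_two : cantorSelfMap 2 2 = 2 := by
  rw [cantorSelfMap_eq (y := 1) (by rw [cantorUnshift_two]; norm_num),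
    cantorFunction_of_one_le le_rfl]
  norm_num

/-- The values `j = 0` and `j = 2` select the left and right thirds; here the self-similarity
equation is read from the whole to the part. -/
theorem cantorFunction_selfMap {j y : ℝ} (hj : j = 0 ∨ j = 2) (hy : y ∈ Icc (0 : ℝ) 1) :
    cantorFunction ((y + j) / 3) = (cantorFunction y + j / 2) / 2 := by
  obtain ⟨h0, h1⟩ := hy
  rcases hj with rfl | rfl
  · rw [cantorFunction_left (by linarith), show 3 * ((y + 0) / 3) = y by ring]
    ring
  · rw [cantorFunction_right (by linarith), show 3 * ((y + 2) / 3) - 2 = y by ring]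
    ring

theorem cantorSelfMap_mem {j x : ℝ} (hj : j = 0 ∨ j = 2) (hx : x ∈ Icc (0 : ℝ) 2) :
    cantorSelfMap j x ∈ Icc (0 : ℝ) 2 := by
  have h0 := (cantorSelfMap j).monotone hx.1
  have h2 := (cantorSelfMap j).monotone hx.2
  rcases hj with rfl | rfl
  · rw [cantorSelfMap_zero_zero] at h0
    rw [cantorSelfMap_zero_two] at h2
    exact ⟨h0, h2.trans (by norm_num)⟩
  · rw [cantorSelfMap_two_zero] at h0
    rw [cantorSelfMap_two_two] at h2
    exact ⟨le_trans (by norm_num) h0, h2⟩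

/-- The distribution of the upper left entry of the Hamiltonian. -/
noncomputable def cantorMass : Measure ℝ := volume.restrict cantorStringSet

/-- The distribution of the lower right entry of the Hamiltonian. -/
noncomputable def cantorLength : Measure ℝ := volume.restrict cantorStringSetᶜ

theorem cantorMass_le : cantorMass ≤ volume := Measure.restrict_le_self

theorem cantorLength_le : cantorLength ≤ volume := Measure.restrict_le_self

theorem cantorMass_Ioc {a b : ℝ} (ha : 0 ≤ a) (hab : a ≤ b) (hb : b ≤ 2) :
    cantorMass (Ioc a b) = ENNReal.ofReal (cantorUnshift b - cantorUnshift a) := by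
  rw [cantorMass, Measure.restrict_apply measurableSet_Ioc,
    volume_Ioc_inter_cantorStringSet ha hab hb]

theorem cantorLength_Ioc {a b : ℝ} (ha : 0 ≤ a) (hab : a ≤ b) (hb : b ≤ 2) :
    cantorLength (Ioc a b) =
      ENNReal.ofReal (cantorFunction (cantorUnshift b) - cantorFunction (cantorUnshift a)) := by
  rw [cantorLength, Measure.restrict_apply measurableSet_Ioc,
    volume_Ioc_inter_compl_cantorStringSet ha hab hb]

theorem integral_cantorMass_selfMap {j : ℝ} (hj : j = 0 ∨ j = 2) (f : ℝ → ℂ) {x : ℝ}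
    (hx : x ∈ Icc (0 : ℝ) 2) :
    ∫ t in (cantorSelfMap j 0)..(cantorSelfMap j x), f t ∂cantorMass =
      1 / 3 * ∫ t in (0 : ℝ)..x, f (cantorSelfMap j t) ∂cantorMass := by
  have := isLocallyFiniteMeasure_of_le_volume cantorMass_le
  rw [intervalIntegral_comp_orderIso (cantorSelfMap j) (k := 1 / 3) (by norm_num) ?_ f hx]
  · push_cast; rfl
  intro a b ha hab hb
  rw [cantorMass_Ioc ha hab hb, cantorMass_Ioc
    (cantorSelfMap_mem hj ⟨ha, hab.trans hb⟩).1 ((cantorSelfMap j).monotone hab)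
    (cantorSelfMap_mem hj ⟨ha.trans hab, hb⟩).2, ← ENNReal.ofReal_mul (by norm_num),
    cantorUnshift_selfMap, cantorUnshift_selfMap]
  congr 1
  ring

theorem integral_cantorLength_selfMap {j : ℝ} (hj : j = 0 ∨ j = 2) (f : ℝ → ℂ) {x : ℝ}
    (hx : x ∈ Icc (0 : ℝ) 2) :
    ∫ t in (cantorSelfMap j 0)..(cantorSelfMap j x), f t ∂cantorLength =
      1 / 2 * ∫ t in (0 : ℝ)..x, f (cantorSelfMap j t) ∂cantorLength := by
  have := isLocallyFiniteMeasure_of_le_volume cantorLength_le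
  rw [intervalIntegral_comp_orderIso (cantorSelfMap j) (k := 1 / 2) (by norm_num) ?_ f hx]
  · push_cast; rfl
  intro a b ha hab hb
  have ha' : a ∈ Icc (0 : ℝ) 2 := ⟨ha, hab.trans hb⟩
  have hb' : b ∈ Icc (0 : ℝ) 2 := ⟨ha.trans hab, hb⟩
  rw [cantorLength_Ioc ha hab hb, cantorLength_Ioc
    (cantorSelfMap_mem hj ha').1 ((cantorSelfMap j).monotone hab)
    (cantorSelfMap_mem hj hb').2, ← ENNReal.ofReal_mul (by norm_num),
    cantorUnshift_selfMap, cantorUnshift_selfMap,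
    cantorFunction_selfMap hj (cantorUnshift_mem ha'),
    cantorFunction_selfMap hj (cantorUnshift_mem hb')]
  congr 1
  ring

theorem cantorUnshift_five_sixths : cantorUnshift (5 / 6) = 1 / 3 := by
  rw [← cantorSelfMap_zero_two, cantorUnshift_selfMap, cantorUnshift_two]; norm_num

theorem cantorUnshift_seven_sixths : cantorUnshift (7 / 6) = 2 / 3 := by
  rw [← cantorSelfMap_two_zero, cantorUnshift_selfMap, cantorUnshift_zero]; norm_num

theorem cantorLength_middle : cantorLength (Ioc (5 / 6) (7 / 6)) = 0 := by
  rw [cantorLength_Ioc (by norm_num) (by norm_num) (by norm_num), cantorUnshift_five_sixths,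
    cantorUnshift_seven_sixths, cantorFunction_middle (by norm_num) (by norm_num),
    cantorFunction_middle (by norm_num) (by norm_num)]
  simp

theorem cantorMass_middle : cantorMass (Ioc (5 / 6) (7 / 6)) = ENNReal.ofReal (1 / 3) := by
  rw [cantorMass_Ioc (by norm_num) (by norm_num) (by norm_num), cantorUnshift_five_sixths,
    cantorUnshift_seven_sixths]
  norm_num

/-! ### The recursion for the transfer matrix -/

namespace IsStringSolution

theorem fst_sub {α β : Measure ℝ} (hβ : β ≤ volume) {w : ℂ} {u v : ℝ → ℂ}
    (h : IsStringSolution α β w u v) {x y : ℝ} (hx : x ∈ Icc (0 : ℝ) 2)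
    (hy : y ∈ Icc (0 : ℝ) 2) : u y = u x + ∫ t in x..y, v t ∂β := by
  have h0 : (0 : ℝ) ∈ Icc (0 : ℝ) 2 := by simp
  rw [h.3 x hx, h.3 y hy, add_assoc, intervalIntegral.integral_add_adjacent_intervals
    (h.2.intervalIntegrable_of_le_volume hβ h0 hx) (h.2.intervalIntegrable_of_le_volume hβ hx hy)]

theorem snd_sub {α β : Measure ℝ} (hα : α ≤ volume) {w : ℂ} {u v : ℝ → ℂ}
    (h : IsStringSolution α β w u v) {x y : ℝ} (hx : x ∈ Icc (0 : ℝ) 2)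
    (hy : y ∈ Icc (0 : ℝ) 2) : v y = v x + w * ∫ t in x..y, u t ∂α := by
  have h0 : (0 : ℝ) ∈ Icc (0 : ℝ) 2 := by simp
  rw [h.4 x hx, h.4 y hy, add_assoc, ← mul_add, intervalIntegral.integral_add_adjacent_intervals
    (h.1.intervalIntegrable_of_le_volume hα h0 hx) (h.1.intervalIntegrable_of_le_volume hα hx hy)]

variable {w : ℂ} {u v : ℝ → ℂ}

/-- The contraction `1/2` of length is absorbed into `v`; combined with the contraction `1/3` of
mass it turns `w` into `w / 6`. -/
theorem comp_cantorSelfMap (h : IsStringSolution cantorMass cantorLength w u v) {j : ℝ}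
    (hj : j = 0 ∨ j = 2) :
    IsStringSolution cantorMass cantorLength (w / 6) (fun x => u (cantorSelfMap j x))
      (fun x => v (cantorSelfMap j x) / 2) := by
  have hm : MapsTo (cantorSelfMap j) (Icc 0 2) (Icc 0 2) := fun x hx => cantorSelfMap_mem hj hx
  have hc := (cantorSelfMap j).continuous.continuousOn (s := Icc 0 2)
  have h0 : (0 : ℝ) ∈ Icc (0 : ℝ) 2 := by simp
  refine ⟨h.1.comp hc hm, (h.2.comp hc hm).div_const 2, fun x hx => ?_, fun x hx => ?_⟩
  · rw [h.fst_sub cantorLength_le (hm h0) (hm hx), integral_cantorLength_selfMap hj v hx,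
      intervalIntegral.integral_div]
    ring
  · rw [h.snd_sub cantorMass_le (hm h0) (hm hx), integral_cantorMass_selfMap hj u hx]
    ring

theorem fst_middle (h : IsStringSolution cantorMass cantorLength w u v) {x : ℝ}
    (hx : x ∈ Icc (5 / 6 : ℝ) (7 / 6)) : u x = u (5 / 6) := by
  rw [h.fst_sub cantorLength_le (x := 5 / 6) (y := x) (by constructor <;> norm_num)
    ⟨by linarith [hx.1], by linarith [hx.2]⟩, intervalIntegral.integral_of_le hx.1,
    Measure.restrict_eq_zero.2 (measure_mono_null (Ioc_subset_Ioc_right hx.2)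
      cantorLength_middle), integral_zero_measure, add_zero]

/-- Over the gap `u` is constant, so `v` jumps by `w` times the mass `1/3` times that constant. -/
theorem snd_middle (h : IsStringSolution cantorMass cantorLength w u v) :
    v (7 / 6) = v (5 / 6) + w / 3 * u (5 / 6) := by
  rw [h.snd_sub cantorMass_le (x := 5 / 6) (y := 7 / 6) (by constructor <;> norm_num)
    (by constructor <;> norm_num), intervalIntegral.integral_of_le (by norm_num),
    setIntegral_congr_fun measurableSet_Ioc
      (g := fun _ => u (5 / 6)) fun t ht => h.fst_middle ⟨ht.1.le, ht.2⟩,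
    setIntegral_const, measureReal_def, cantorMass_middle,
    ENNReal.toReal_ofReal (by norm_num), Complex.real_smul]
  push_cast
  ring

end IsStringSolution

/-- The entries of the transfer matrix of the Cantor string, as functions of `w`. -/
noncomputable def cantorEntry (w : ℂ) : Matrix (Fin 2) (Fin 2) ℂ :=
  !![stringFst cantorMass cantorLength 1 0 w 2, stringFst cantorMass cantorLength 0 1 w 2;
    stringSnd cantorMass cantorLength 1 0 w 2, stringSnd cantorMass cantorLength 0 1 w 2]

namespace IsStringSolution

variable {w : ℂ} {u v : ℝ → ℂ}

theorem apply_two (h : IsStringSolution cantorMass cantorLength w u v) :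
    u 2 = u 0 * cantorEntry w 0 0 + v 0 * cantorEntry w 0 1 ∧
      v 2 = u 0 * cantorEntry w 1 0 + v 0 * cantorEntry w 1 1 :=
  h.eq_linearCombination cantorMass_le cantorLength_le (by simp)

/-- Left third, gap, right third. With `N = !![P, Q; R, S]` and `D = diag(1, 2)`, the matrix applied
to `(u 0, v 0)` is `D N D⁻¹ * !![1, 0; w / 3, 1] * D N D⁻¹`. -/
theorem apply_two_eq_div_six (h : IsStringSolution cantorMass cantorLength w u v)
    {P Q R S : ℂ} (hP : P = cantorEntry (w / 6) 0 0) (hQ : Q = cantorEntry (w / 6) 0 1)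
    (hR : R = cantorEntry (w / 6) 1 0) (hS : S = cantorEntry (w / 6) 1 1) :
    u 2 = u 0 * (P * P + w / 6 * P * Q + Q * R) +
        v 0 * ((P + w / 6 * Q + S) * Q / 2) ∧
      v 2 = u 0 * (2 * R * P + w / 3 * S * P + 2 * S * R) +
        v 0 * (R * Q + w / 6 * S * Q + S * S) := by
  have h1 := (h.comp_cantorSelfMap (Or.inl rfl)).apply_two
  have h2 := (h.comp_cantorSelfMap (Or.inr rfl)).apply_two
  simp only [cantorSelfMap_zero_zero, cantorSelfMap_zero_two, cantorSelfMap_two_zero,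
    cantorSelfMap_two_two, h.snd_middle, h.fst_middle (x := 7 / 6) (by constructor <;> norm_num),
    ← hP, ← hQ, ← hR, ← hS] at h1 h2
  obtain ⟨h1u, h1v⟩ := h1
  obtain ⟨h2u, h2v⟩ := h2
  constructor
  · linear_combination h2u + (P + w / 6 * Q) * h1u + Q * h1v
  · linear_combination 2 * h2v + 2 * (R + w / 6 * S) * h1u + 2 * S * h1v

end IsStringSolution

theorem cantorEntry_eq {w P Q R S : ℂ} (hP : P = cantorEntry (w / 6) 0 0)
    (hQ : Q = cantorEntry (w / 6) 0 1) (hR : R = cantorEntry (w / 6) 1 0)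
    (hS : S = cantorEntry (w / 6) 1 1) :
    cantorEntry w = !![P * P + w / 6 * P * Q + Q * R, (P + w / 6 * Q + S) * Q / 2;
      2 * R * P + w / 3 * S * P + 2 * S * R, R * Q + w / 6 * S * Q + S * S] := by
  have h1 := (isStringSolution_string cantorMass_le cantorLength_le zero_le_one le_rfl
    w).apply_two_eq_div_six hP hQ hR hS
  have h2 := (isStringSolution_string cantorMass_le cantorLength_le le_rfl zero_le_one
    w).apply_two_eq_div_six hP hQ hR hS
  simp only [stringFst_zero, stringSnd_zero, Complex.ofReal_one, Complex.ofReal_zero, one_mul,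
    zero_mul, add_zero, zero_add] at h1 h2
  rw [cantorEntry, h1.1, h1.2, h2.1, h2.2]

/-! ### Growth of the entries along powers of 6 -/

theorem norm_cantorEntry_le {w : ℂ} {r : ℝ} (hw : ‖w‖ ≤ r) (i j : Fin 2) :
    ‖cantorEntry w i j‖ ≤ ‖cantorEntry r i j‖ := by
  have h1 := norm_string_le cantorMass_le cantorLength_le zero_le_one le_rfl w (x := 2)
    (by simp) hw
  have h2 := norm_string_le cantorMass_le cantorLength_le le_rfl zero_le_one w (x := 2)
    (by simp) hw
  fin_cases i <;> fin_cases j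
  · exact h1.1
  · exact h2.1
  · exact h1.2
  · exact h2.2

theorem integral_one_cantorLength : ∫ _ in (0 : ℝ)..2, (1 : ℝ) ∂cantorLength = 1 := by
  rw [intervalIntegral.integral_of_le zero_le_two, setIntegral_const, measureReal_def,
    cantorLength_Ioc le_rfl zero_le_two le_rfl, cantorUnshift_zero, cantorUnshift_two,
    cantorFunction_of_nonpos le_rfl, cantorFunction_of_one_le le_rfl]
  simp

/-- For nonnegative `r`, the entries are real and dominate those of the triangular matrix
`!![1, 1; 0, 1]`. -/
theorem exists_cantorEntry_ofReal {r : ℝ} (hr : 0 ≤ r) : ∃ P Q R S : ℝ,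
    cantorEntry r = !![(P : ℂ), (Q : ℂ); (R : ℂ), (S : ℂ)] ∧ 1 ≤ P ∧ 1 ≤ Q ∧ 0 ≤ R ∧ 1 ≤ S := by
  obtain ⟨⟨P, hP, hP1⟩, R, hR, hR1⟩ := string_ofReal cantorMass_le cantorLength_le zero_le_one
    le_rfl hr (x := 2) (by simp)
  obtain ⟨⟨Q, hQ, hQ1⟩, S, hS, hS1⟩ := string_ofReal cantorMass_le cantorLength_le le_rfl
    zero_le_one hr (x := 2) (by simp)
  simp only [stringCoeff, integral_one_cantorLength, zero_add] at hP1 hQ1 hR1 hS1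
  refine ⟨P, Q, R, S, by rw [cantorEntry, hP, hQ, hR, hS], ?_, hQ1, hR1, hS1⟩
  simpa using hP1

/-- If the entries at `w / 6` are at most `a`, the recursion bounds those at `w` by `6 ^ (n + 1) * a
^ 2`. The weight `6 ^ (n + 2)` is chosen so that this closes exactly: `(n + 1) + (n + 3) = 2 (n +
2)`. -/
theorem exists_norm_cantorEntry_mul_le : ∃ X : ℝ, 1 ≤ X ∧ ∀ (n : ℕ) (w : ℂ), ‖w‖ ≤ 6 ^ n →
    ∀ i j, ‖cantorEntry w i j‖ * 6 ^ (n + 2) ≤ X ^ 2 ^ n := by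
  set m := ∑ i, ∑ j, ‖cantorEntry (1 : ℝ) i j‖ with hm
  have hm0 : 0 ≤ m := by positivity
  have hmle : ∀ i j, ‖cantorEntry (1 : ℝ) i j‖ ≤ m := by
    intro i j
    refine le_trans ?_ (Finset.single_le_sum (f := fun i => ∑ j, ‖cantorEntry (1 : ℝ) i j‖)
      (fun i _ => by positivity) (Finset.mem_univ i))
    exact Finset.single_le_sum (f := fun j => ‖cantorEntry (1 : ℝ) i j‖)
      (fun i _ => norm_nonneg _) (Finset.mem_univ j)
  -- Here 36 is the weight `6 ^ (n + 2)` at `n = 0`; the added 1 ensures `1 ≤ X`.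
  refine ⟨36 * m + 1, by linarith, fun n => ?_⟩
  set X := 36 * m + 1
  induction n with
  | zero =>
    intro w hw i j
    have := (norm_cantorEntry_le (r := 1) (by simpa using hw) i j).trans (hmle i j)
    norm_num
    linarith
  | succ n ih =>
    intro w hw
    have hw' : ‖w / 6‖ ≤ 6 ^ n := by
      rw [norm_div, Complex.norm_ofNat, div_le_iff₀ (by norm_num), ← pow_succ]
      exact hw
    have h6 : (1 : ℝ) ≤ 6 ^ n := one_le_pow₀ (by norm_num)
    set P := cantorEntry (w / 6) 0 0 with hP
    set Q := cantorEntry (w / 6) 0 1 with hQ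
    set R := cantorEntry (w / 6) 1 0 with hR
    set S := cantorEntry (w / 6) 1 1 with hS
    set a := X ^ 2 ^ n / 6 ^ (n + 2) with ha
    have ha0 : 0 ≤ a := by positivity
    have hb : ∀ i j, ‖cantorEntry (w / 6) i j‖ ≤ a := fun i j =>
      (le_div_iff₀ (by positivity)).2 (ih _ hw' i j)
    have hPa := hb 0 0
    have hQa := hb 0 1
    have hRa := hb 1 0
    have hSa := hb 1 1
    rw [← hP] at hPa
    rw [← hQ] at hQa
    rw [← hR] at hRa
    rw [← hS] at hSa
    have hmul : ∀ {p q : ℂ}, ‖p‖ ≤ a → ‖q‖ ≤ a → ‖p * q‖ ≤ a * a := fun hp hq => by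
      rw [norm_mul]; exact mul_le_mul hp hq (norm_nonneg _) ha0
    have hwmul : ∀ {p q : ℂ}, ‖p‖ ≤ a → ‖q‖ ≤ a → ‖w / 6 * (p * q)‖ ≤ 6 ^ n * (a * a) :=
      fun hp hq => by
        rw [norm_mul]; exact mul_le_mul hw' (hmul hp hq) (norm_nonneg _) (by positivity)
    have haa : a * a ≤ 6 ^ n * (a * a) := le_mul_of_one_le_left (by positivity) h6
    have haa0 : 0 ≤ 6 ^ n * (a * a) := by positivity
    have hX : X ^ 2 ^ (n + 1) = 6 ^ (n + 1) * (a * a) * 6 ^ (n + 3) := by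
      rw [ha, pow_succ 2 n, pow_mul, div_mul_div_comm]
      field_simp
      ring
    intro i j
    rw [hX]
    refine mul_le_mul_of_nonneg_right ?_ (by positivity)
    rw [cantorEntry_eq hP hQ hR hS, pow_succ]
    fin_cases i <;> fin_cases j
    · change ‖P * P + w / 6 * P * Q + Q * R‖ ≤ _
      have := norm_add₃_le (a := P * P) (b := w / 6 * P * Q) (c := Q * R)
      have h1 := hmul hPa hPa
      have h2 := hwmul hPa hQa
      have h3 := hmul hQa hRa
      rw [← mul_assoc] at h2
      linarith
    · change ‖(P + w / 6 * Q + S) * Q / 2‖ ≤ _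
      rw [show (P + w / 6 * Q + S) * Q / 2 = (P * Q + w / 6 * (Q * Q) + S * Q) / 2 by ring,
        norm_div, Complex.norm_ofNat]
      have := norm_add₃_le (a := P * Q) (b := w / 6 * (Q * Q)) (c := S * Q)
      have h1 := hmul hPa hQa
      have h2 := hwmul hQa hQa
      have h3 := hmul hSa hQa
      linarith
    · change ‖2 * R * P + w / 3 * S * P + 2 * S * R‖ ≤ _
      rw [show 2 * R * P + w / 3 * S * P + 2 * S * R =
        2 * (R * P + w / 6 * (S * P) + S * R) by ring, norm_mul, Complex.norm_ofNat]
      have := norm_add₃_le (a := R * P) (b := w / 6 * (S * P)) (c := S * R)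
      have h1 := hmul hRa hPa
      have h2 := hwmul hSa hPa
      have h3 := hmul hSa hRa
      linarith
    · change ‖R * Q + w / 6 * S * Q + S * S‖ ≤ _
      have := norm_add₃_le (a := R * Q) (b := w / 6 * S * Q) (c := S * S)
      have h1 := hmul hRa hQa
      have h2 := hwmul hSa hQa
      have h3 := hmul hSa hSa
      rw [← mul_assoc] at h2
      linarith

/-- Lower bounds for the entries at `r` by the upper left entry at `r / 6`. -/
theorem le_norm_cantorEntry {r : ℝ} (hr : 0 ≤ r) :
    1 + r / 6 ≤ ‖cantorEntry r 0 0‖ ∧ 1 + r / 6 ≤ ‖cantorEntry r 1 1‖ ∧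
      ‖cantorEntry (r / 6 : ℝ) 0 0‖ ^ 2 ≤ ‖cantorEntry r 0 0‖ ∧
      ‖cantorEntry (r / 6 : ℝ) 1 1‖ ^ 2 ≤ ‖cantorEntry r 1 1‖ ∧
      ‖cantorEntry (r / 6 : ℝ) 0 0‖ / 2 ≤ ‖cantorEntry r 0 1‖ ∧
      r / 3 * ‖cantorEntry (r / 6 : ℝ) 0 0‖ ≤ ‖cantorEntry r 1 0‖ := by
  obtain ⟨P, Q, R, S, h, hP, hQ, hR, hS⟩ := exists_cantorEntry_ofReal (r := r / 6) (by positivity)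
  have he := cantorEntry_eq (w := r) (P := P) (Q := Q) (R := R) (S := S)
    (by rw [show (r : ℂ) / 6 = ((r / 6 : ℝ) : ℂ) by push_cast; rfl, h]; rfl)
    (by rw [show (r : ℂ) / 6 = ((r / 6 : ℝ) : ℂ) by push_cast; rfl, h]; rfl)
    (by rw [show (r : ℂ) / 6 = ((r / 6 : ℝ) : ℂ) by push_cast; rfl, h]; rfl)
    (by rw [show (r : ℂ) / 6 = ((r / 6 : ℝ) : ℂ) by push_cast; rfl, h]; rfl)
  have h00 : P * P + r / 6 * P * Q + Q * R ≤ ‖cantorEntry r 0 0‖ := by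
    rw [he]
    refine (le_abs_self _).trans (le_of_eq ?_)
    rw [← Real.norm_eq_abs, ← Complex.norm_real]
    push_cast; rfl
  have h01 : (P + r / 6 * Q + S) * Q / 2 ≤ ‖cantorEntry r 0 1‖ := by
    rw [he]
    refine (le_abs_self _).trans (le_of_eq ?_)
    rw [← Real.norm_eq_abs, ← Complex.norm_real]
    push_cast; rfl
  have h10 : 2 * R * P + r / 3 * S * P + 2 * S * R ≤ ‖cantorEntry r 1 0‖ := by
    rw [he]
    refine (le_abs_self _).trans (le_of_eq ?_)
    rw [← Real.norm_eq_abs, ← Complex.norm_real]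
    push_cast; rfl
  have h11 : R * Q + r / 6 * S * Q + S * S ≤ ‖cantorEntry r 1 1‖ := by
    rw [he]
    refine (le_abs_self _).trans (le_of_eq ?_)
    rw [← Real.norm_eq_abs, ← Complex.norm_real]
    push_cast; rfl
  have hPn : ‖cantorEntry (r / 6 : ℝ) 0 0‖ = P := by
    rw [h]
    change ‖(P : ℂ)‖ = P
    rw [Complex.norm_real, Real.norm_of_nonneg (by linarith)]
  have hSn : ‖cantorEntry (r / 6 : ℝ) 1 1‖ = S := by
    rw [h]
    change ‖(S : ℂ)‖ = S
    rw [Complex.norm_real, Real.norm_of_nonneg (by linarith)]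
  rw [hPn, hSn]
  have hP0 : 0 ≤ P := by linarith
  have hQ0 : 0 ≤ Q := by linarith
  have hS0 : 0 ≤ S := by linarith
  have hPQ : 1 ≤ P * Q := one_le_mul_of_one_le_of_one_le hP hQ
  have hSQ : 1 ≤ S * Q := one_le_mul_of_one_le_of_one_le hS hQ
  have hPP : 1 ≤ P * P := one_le_mul_of_one_le_of_one_le hP hP
  have hSS : 1 ≤ S * S := one_le_mul_of_one_le_of_one_le hS hS
  have hPQ' : P ≤ P * Q := le_mul_of_one_le_right hP0 hQ
  have hPS' : P ≤ S * P := le_mul_of_one_le_left hP0 hS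
  have hQR : 0 ≤ Q * R := mul_nonneg hQ0 hR
  have hRP : 0 ≤ R * P := mul_nonneg hR hP0
  have hSR : 0 ≤ S * R := mul_nonneg hS0 hR
  have hr6 : 0 ≤ r / 6 := by positivity
  have hr3 : 0 ≤ r / 3 := by positivity
  have e1 := mul_le_mul_of_nonneg_left hPQ hr6
  have e2 := mul_le_mul_of_nonneg_left hSQ hr6
  have e3 := mul_le_mul_of_nonneg_left hPS' hr3
  have e4 : 0 ≤ r / 6 * (Q * Q) := by positivity
  refine ⟨by linarith, by linarith, by linarith, by linarith, by linarith, by linarith⟩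

/-- The start `7 / 6` is the bound `1 + r / 6` at `r = 1`; each further factor 6 squares it. The
bound exceeds 1, which is what makes the growth doubly exponential. -/
theorem pow_le_norm_cantorEntry (n : ℕ) :
    (7 / 6 : ℝ) ^ 2 ^ n ≤ ‖cantorEntry ((6 ^ n : ℝ) : ℂ) 0 0‖ ∧
      (7 / 6 : ℝ) ^ 2 ^ n ≤ ‖cantorEntry ((6 ^ n : ℝ) : ℂ) 1 1‖ := by
  induction n with
  | zero =>
    have h := le_norm_cantorEntry (r := 6 ^ 0) (by positivity)
    exact ⟨le_trans (by norm_num) h.1, le_trans (by norm_num) h.2.1⟩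
  | succ n ih =>
    have h := le_norm_cantorEntry (r := 6 ^ (n + 1)) (by positivity)
    rw [show (6 : ℝ) ^ (n + 1) / 6 = 6 ^ n by rw [pow_succ]; ring] at h
    rw [pow_succ 2 n, pow_mul]
    exact ⟨(pow_le_pow_left₀ (by positivity) ih.1 2).trans h.2.2.1,
      (pow_le_pow_left₀ (by positivity) ih.2 2).trans h.2.2.2.1⟩

/-! ### From doubly exponential bounds to the order -/

/-- When `6 ^ n` is comparable to `‖z‖ ^ 2`, `2 ^ n` is comparable to `‖z‖ ^ ρ`. The factor `‖z‖` in
the upper bound, and the shift between `n` and `n + 1` in the lower one, disappear in the limit. -/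
theorem entireOrder_eq_of_bounds {f : ℂ → ℂ} {X c : ℝ} (hX : 1 ≤ X) (hc : 1 < c)
    (hu : ∀ (n : ℕ) (z : ℂ), 1 ≤ ‖z‖ → ‖z‖ ^ 2 ≤ 6 ^ n → ‖f z‖ ≤ ‖z‖ * X ^ 2 ^ n)
    (hl : ∀ᶠ n : ℕ in atTop, c ^ 2 ^ n ≤ ‖f (Complex.I * (Real.sqrt 6 ^ (n + 1) : ℝ))‖) :
    entireOrder f = ((2 / Real.logb 2 6 : ℝ) : EReal) := by
  set ρ := 2 / Real.logb 2 6 with hρ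
  have hl2 : 0 < Real.log 2 := Real.log_pos (by norm_num)
  have hl6 : 0 < Real.log 6 := Real.log_pos (by norm_num)
  have hρe : ρ = Real.log 2 / (Real.log 6 / 2) := by
    rw [hρ, Real.logb]; field_simp
  have hρ0 : 0 < ρ := by rw [hρe]; positivity
  refine le_antisymm ?_ ?_
  -- `1 / ρ` pays for the factor `‖z‖` through `log t ≤ t ^ ρ / ρ`, `2 * log X` for the main term,
  -- and the 1 makes `C ≥ 1`.
  · set C := 1 + 1 / ρ + 2 * Real.log X with hC
    have hC1 : 1 ≤ C := by
      have := Real.log_nonneg hX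
      have : 0 < 1 / ρ := by positivity
      linarith
    have hlim : Tendsto (fun z : ℂ => ((ρ + Real.log C / Real.log ‖z‖ : ℝ) : EReal))
        (Bornology.cobounded ℂ) (nhds (ρ : EReal)) := by
      rw [EReal.tendsto_coe]
      simpa using ((Real.tendsto_log_atTop.comp
        (tendsto_norm_cobounded_atTop (E := ℂ))).const_div_atTop (Real.log C)).const_add ρ
    rw [← hlim.limsup_eq, entireOrder]
    refine limsup_le_limsup ?_
    filter_upwards [(tendsto_norm_cobounded_atTop (E := ℂ)).eventually_ge_atTop 2] with z hz
    have hz1 : 1 ≤ ‖z‖ := by linarith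
    have hz0 : 0 < ‖z‖ := by linarith
    have hlz : 0 < Real.log ‖z‖ := Real.log_pos (by linarith)
    rw [EReal.coe_le_coe_iff, ← sub_nonneg]
    have ht1 : 1 ≤ ‖z‖ ^ ρ := Real.one_le_rpow hz1 hρ0.le
    -- Take the least `n` with `‖z‖ ^ 2 ≤ 6 ^ n`; rounding up costs at most the factor 2.
    obtain ⟨n, hn1, hn2⟩ : ∃ n : ℕ, ‖z‖ ^ 2 ≤ 6 ^ n ∧ (2 : ℝ) ^ n ≤ 2 * ‖z‖ ^ ρ := by
      refine ⟨⌈Real.logb 6 (‖z‖ ^ 2)⌉₊, ?_, ?_⟩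
      · rw [← Real.rpow_natCast 6, ← Real.logb_le_iff_le_rpow (by norm_num) (by positivity)]
        exact Nat.le_ceil _
      · have h0 : 0 ≤ Real.logb 6 (‖z‖ ^ 2) :=
          Real.logb_nonneg (by norm_num) (one_le_pow₀ hz1)
        rw [← Real.rpow_natCast 2]
        calc (2 : ℝ) ^ ((⌈Real.logb 6 (‖z‖ ^ 2)⌉₊ : ℕ) : ℝ)
            ≤ 2 ^ (Real.logb 6 (‖z‖ ^ 2) + 1) :=
              Real.rpow_le_rpow_of_exponent_le (by norm_num) (Nat.ceil_lt_add_one h0).le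
          _ = 2 * ‖z‖ ^ ρ := by
              rw [Real.rpow_add two_pos, Real.rpow_one, mul_comm,
                Real.rpow_def_of_pos two_pos, Real.rpow_def_of_pos hz0, Real.logb,
                Real.log_pow, hρe]
              congr 2
              push_cast
              field_simp
    have hp1 : Real.posLog ‖f z‖ ≤ C * ‖z‖ ^ ρ := by
      have h1 : 1 ≤ ‖z‖ * X ^ 2 ^ n :=
        one_le_mul_of_one_le_of_one_le hz1 (one_le_pow₀ hX)
      calc Real.posLog ‖f z‖ ≤ Real.posLog (‖z‖ * X ^ 2 ^ n) :=
            Real.posLog_le_posLog (norm_nonneg _) (hu n z hz1 hn1)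
        _ = Real.log ‖z‖ + 2 ^ n * Real.log X := by
            rw [Real.posLog_eq_log (by rwa [abs_of_nonneg (by linarith)]),
              Real.log_mul hz0.ne' (by positivity), Real.log_pow]
            push_cast; rfl
        _ ≤ ‖z‖ ^ ρ / ρ + 2 * ‖z‖ ^ ρ * Real.log X :=
            add_le_add (Real.log_le_rpow_div hz0.le hρ0)
              (mul_le_mul_of_nonneg_right hn2 (Real.log_nonneg hX))
        _ ≤ C * ‖z‖ ^ ρ := by
            rw [hC, add_mul, add_mul, one_mul]
            have : 1 / ρ * ‖z‖ ^ ρ = ‖z‖ ^ ρ / ρ := by ring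
            linarith
    have hp2 : Real.posLog (Real.posLog ‖f z‖) ≤ Real.log C + ρ * Real.log ‖z‖ := by
      have h1 : 1 ≤ C * ‖z‖ ^ ρ := one_le_mul_of_one_le_of_one_le hC1 ht1
      refine (Real.posLog_le_posLog Real.posLog_nonneg hp1).trans (le_of_eq ?_)
      rw [Real.posLog_eq_log (by rwa [abs_of_nonneg (by linarith)]),
        Real.log_mul (by positivity) (by positivity), Real.log_rpow hz0]
    rw [sub_nonneg, div_le_iff₀ hlz, add_mul, div_mul_cancel₀ _ hlz.ne']
    linarith
  · set k := Real.log (Real.log c) with hk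
    set seq : ℕ → ℂ := fun n => Complex.I * (Real.sqrt 6 ^ (n + 1) : ℝ) with hseq
    have hs6 : 1 < Real.sqrt 6 := by
      rw [Real.lt_sqrt zero_le_one]; norm_num
    have hnorm : ∀ n, ‖seq n‖ = Real.sqrt 6 ^ (n + 1) := fun n => by
      rw [hseq]
      simp only
      rw [norm_mul, Complex.norm_I, one_mul, Complex.norm_real,
        Real.norm_of_nonneg (by positivity)]
    have hseqt : Tendsto seq atTop (Bornology.cobounded ℂ) := by
      rw [← tendsto_norm_atTop_iff_cobounded]
      simp only [hnorm]
      exact (tendsto_pow_atTop_atTop_of_one_lt hs6).comp (tendsto_add_atTop_nat 1)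
    -- The quotient differs from `ρ` by a constant over `n + 1`; the sign of `k` is irrelevant.
    have hlim : Tendsto (fun n : ℕ =>
        (((n * Real.log 2 + k) / ((n + 1) * (Real.log 6 / 2)) : ℝ) : EReal)) atTop
        (nhds (ρ : EReal)) := by
      rw [EReal.tendsto_coe]
      have h := (tendsto_one_div_add_atTop_nhds_zero_nat (𝕜 := ℝ)).mul_const
        ((k - Real.log 2) / (Real.log 6 / 2)) |>.const_add ρ
      rw [zero_mul, add_zero] at h
      refine h.congr fun n => ?_
      rw [hρe]
      field_simp
      ring
    rw [← hlim.limsup_eq]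
    refine le_trans (limsup_le_limsup ?_) (limsup_le_limsup_of_le hseqt)
    filter_upwards [hl] with n hn
    have hlc : 0 < Real.log c := Real.log_pos hc
    have hlog : Real.log ‖seq n‖ = (n + 1) * (Real.log 6 / 2) := by
      rw [hnorm, Real.log_pow, Real.log_sqrt (by norm_num)]
      push_cast; rfl
    rw [EReal.coe_le_coe_iff, hlog]
    refine div_le_div_of_nonneg_right ?_ (by positivity)
    have h1 : (2 : ℝ) ^ n * Real.log c ≤ Real.posLog ‖f (seq n)‖ := by
      calc (2 : ℝ) ^ n * Real.log c = Real.log (c ^ 2 ^ n) := by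
            rw [Real.log_pow]; push_cast; rfl
        _ ≤ Real.posLog (c ^ 2 ^ n) := le_max_right _ _
        _ ≤ _ := Real.posLog_le_posLog (by positivity) hn
    calc n * Real.log 2 + k = Real.log ((2 : ℝ) ^ n * Real.log c) := by
          rw [Real.log_mul (by positivity) hlc.ne', Real.log_pow]
      _ ≤ Real.posLog ((2 : ℝ) ^ n * Real.log c) := le_max_right _ _
      _ ≤ _ := Real.posLog_le_posLog (by positivity) h1

/-! ### From the canonical system to the string and back -/

theorem cantorHamiltonian_mul_apply_zero (M : ℝ → Matrix (Fin 2) (Fin 2) ℂ) (j : Fin 2) :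
    (fun t => (cantorHamiltonian t * M t) 0 j) =
      cantorStringSet.indicator fun t => M t 0 j := by
  ext t
  by_cases h : t ∈ cantorStringSet <;> simp [cantorHamiltonian, h, Matrix.mul_apply]

theorem cantorHamiltonian_mul_apply_one (M : ℝ → Matrix (Fin 2) (Fin 2) ℂ) (j : Fin 2) :
    (fun t => (cantorHamiltonian t * M t) 1 j) =
      cantorStringSetᶜ.indicator fun t => M t 1 j := by
  ext t
  by_cases h : t ∈ cantorStringSet <;> simp [cantorHamiltonian, h, Matrix.mul_apply]

theorem intervalIntegral_indicator_eq {E : Set ℝ} (hE : MeasurableSet E) (f : ℝ → ℂ) (a b : ℝ) :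
    ∫ t in a..b, E.indicator f t = ∫ t in a..b, f t ∂(volume.restrict E) := by
  simp only [intervalIntegral, integral_indicator hE, Measure.restrict_restrict hE,
    Measure.restrict_restrict measurableSet_Ioc, inter_comm]

theorem symplJ_mul_apply (A : Matrix (Fin 2) (Fin 2) ℂ) (j : Fin 2) :
    (symplJ * A) 0 j = -A 1 j ∧ (symplJ * A) 1 j = A 0 j := by
  simp [symplJ, Matrix.mul_apply]

theorem integral_cantorHamiltonian_mul (M : ℝ → Matrix (Fin 2) (Fin 2) ℂ) (j : Fin 2) (x : ℝ) :
    ∫ t in (0 : ℝ)..x, (cantorHamiltonian t * M t) 0 j =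
        ∫ t in (0 : ℝ)..x, M t 0 j ∂cantorMass ∧
      ∫ t in (0 : ℝ)..x, (cantorHamiltonian t * M t) 1 j =
        ∫ t in (0 : ℝ)..x, M t 1 j ∂cantorLength := by
  rw [cantorHamiltonian_mul_apply_zero, cantorHamiltonian_mul_apply_one]
  exact ⟨intervalIntegral_indicator_eq measurableSet_cantorStringSet _ _ _,
    intervalIntegral_indicator_eq measurableSet_cantorStringSet.compl _ _ _⟩

theorem IsMatrixSolution.apply_zero {H : ℝ → Matrix (Fin 2) (Fin 2) ℂ} {L : ℝ}
    {M : ℂ → ℝ → Matrix (Fin 2) (Fin 2) ℂ} (hM : IsMatrixSolution H L M) (hL : 0 ≤ L) (z : ℂ) :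
    M z 0 = 1 := by
  have h := hM.2 z 0 ⟨le_rfl, hL⟩
  ext i j
  have h0 := h 0 j
  have h1 := h 1 j
  rw [(symplJ_mul_apply _ _).1] at h0
  rw [(symplJ_mul_apply _ _).2] at h1
  simp only [intervalIntegral.integral_same, mul_zero, neg_eq_zero, Matrix.sub_apply,
    sub_eq_zero] at h0 h1
  fin_cases i
  · exact h1
  · exact h0

/-- The rows of the system read `dM₀ = z M₁ dβ` and `dM₁ = -z M₀ dα`; multiplying the second by `z`
leaves `z` only through `-z ^ 2`. -/
theorem IsMatrixSolution.isStringSolution {M : ℂ → ℝ → Matrix (Fin 2) (Fin 2) ℂ}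
    (hM : IsMatrixSolution cantorHamiltonian 2 M) (z : ℂ) (j : Fin 2) :
    IsStringSolution cantorMass cantorLength (-z ^ 2) (fun x => M z x 0 j)
      (fun x => z * M z x 1 j) := by
  have hc : ∀ i, ContinuousOn (fun x => M z x i j) (Icc 0 2) := fun i =>
    ((continuous_apply_apply i j).comp_continuousOn (hM.1 z))
  have h0 := hM.apply_zero zero_le_two z
  refine ⟨hc 0, continuousOn_const.mul (hc 1), fun x hx => ?_, fun x hx => ?_⟩
  · have h := hM.2 z x hx 1 j
    rw [(symplJ_mul_apply _ _).2, (integral_cantorHamiltonian_mul (M z) j x).2,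
      Matrix.sub_apply] at h
    rw [intervalIntegral.integral_const_mul, h0]
    linear_combination h
  · have h := hM.2 z x hx 0 j
    rw [(symplJ_mul_apply _ _).1, (integral_cantorHamiltonian_mul (M z) j x).1,
      Matrix.sub_apply] at h
    simp only [h0]
    linear_combination (-z) * h

theorem exists_isMatrixSolution : ∃ M, IsMatrixSolution cantorHamiltonian 2 M := by
  let u (z : ℂ) : ℝ → ℂ := stringFst cantorMass cantorLength 1 0 (-z ^ 2)
  let v (z : ℂ) : ℝ → ℂ := stringSnd cantorMass cantorLength 1 0 (-z ^ 2)
  let u' (z : ℂ) : ℝ → ℂ := stringFst cantorMass cantorLength 0 1 (-z ^ 2)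
  let v' (z : ℂ) : ℝ → ℂ := stringSnd cantorMass cantorLength 0 1 (-z ^ 2)
  have h1 : ∀ z, IsStringSolution cantorMass cantorLength (-z ^ 2) (u z) (v z) := fun z =>
    isStringSolution_string cantorMass_le cantorLength_le zero_le_one le_rfl _
  have h2 : ∀ z, IsStringSolution cantorMass cantorLength (-z ^ 2) (u' z) (v' z) := fun z =>
    isStringSolution_string cantorMass_le cantorLength_le le_rfl zero_le_one _
  have hu0 : ∀ z, u z 0 = 1 := fun z => by simp [u, stringFst_zero]
  have hv0 : ∀ z, v z 0 = 0 := fun z => by simp [v, stringSnd_zero]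
  have hu0' : ∀ z, u' z 0 = 0 := fun z => by simp [u', stringFst_zero]
  have hv0' : ∀ z, v' z 0 = 1 := fun z => by simp [v', stringSnd_zero]
  -- The lower left entry should be `v / z`; its integral form also makes sense at `z = 0`. The
  -- second column is the string solution `(z u', z v')` with `v` divided by `z`.
  refine ⟨fun z x => !![u z x, z * u' z x; -z * ∫ t in (0 : ℝ)..x, u z t ∂cantorMass, v' z x],
    fun z => ?_, fun z x hx i j => ?_⟩
  · have hv : ContinuousOn (fun x => -z * ∫ t in (0 : ℝ)..x, u z t ∂cantorMass) (Icc 0 2) := by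
      by_cases hz : z = 0
      · simpa [hz] using continuousOn_const
      refine (((h1 z).2.div_const z)).congr fun x hx => ?_
      simp only
      rw [(h1 z).4 x hx, hv0]
      field_simp
      ring
    refine continuousOn_pi.2 fun i => continuousOn_pi.2 fun j => ?_
    fin_cases i <;> fin_cases j
    · exact (h1 z).1
    · exact continuousOn_const.mul (h2 z).1
    · exact hv
    · exact (h2 z).2
  · have hv : ∀ t ∈ Icc (0 : ℝ) 2,
        v z t = z * (-z * ∫ s in (0 : ℝ)..t, u z s ∂cantorMass) := fun t ht => by
      rw [(h1 z).4 t ht, hv0]; ring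
    fin_cases i <;> fin_cases j
    · refine (symplJ_mul_apply _ 0).1.trans ?_
      refine Eq.trans ?_ (congrArg (z * ·) (integral_cantorHamiltonian_mul _ 0 x).1.symm)
      simp
    · refine (symplJ_mul_apply _ 1).1.trans ?_
      refine Eq.trans ?_ (congrArg (z * ·) (integral_cantorHamiltonian_mul _ 1 x).1.symm)
      have := (h2 z).4 x hx
      simp [intervalIntegral.integral_const_mul]
      rw [this, hv0']
      ring
    · refine (symplJ_mul_apply _ 0).2.trans ?_
      refine Eq.trans ?_ (congrArg (z * ·) (integral_cantorHamiltonian_mul _ 0 x).2.symm)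
      have hi : ∫ t in (0 : ℝ)..x, v z t ∂cantorLength =
          z * ∫ t in (0 : ℝ)..x, (-z * ∫ s in (0 : ℝ)..t, u z s ∂cantorMass) ∂cantorLength := by
        rw [← intervalIntegral.integral_const_mul]
        refine intervalIntegral.integral_congr fun t ht => ?_
        rw [uIcc_of_le hx.1] at ht
        exact hv t ⟨ht.1, ht.2.trans hx.2⟩
      have := (h1 z).3 x hx
      rw [hi, hu0] at this
      change u z x - 1 = z * ∫ t in (0 : ℝ)..x,
        (-z * ∫ s in (0 : ℝ)..t, u z s ∂cantorMass) ∂cantorLength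
      rw [this]
      ring
    · refine (symplJ_mul_apply _ 1).2.trans ?_
      refine Eq.trans ?_ (congrArg (z * ·) (integral_cantorHamiltonian_mul _ 1 x).2.symm)
      have := (h2 z).3 x hx
      simp [this, hu0']

/-- The entries of the monodromy matrix in terms of those of the transfer matrix of the string. -/
theorem IsMatrixSolution.apply_two {M : ℂ → ℝ → Matrix (Fin 2) (Fin 2) ℂ}
    (hM : IsMatrixSolution cantorHamiltonian 2 M) {z : ℂ} (hz : z ≠ 0) :
    M z 2 = !![cantorEntry (-z ^ 2) 0 0, z * cantorEntry (-z ^ 2) 0 1;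
      cantorEntry (-z ^ 2) 1 0 / z, cantorEntry (-z ^ 2) 1 1] := by
  have h0 := (hM.isStringSolution z 0).apply_two
  have h1 := (hM.isStringSolution z 1).apply_two
  simp only [hM.apply_zero zero_le_two z] at h0 h1
  ext i j
  fin_cases i <;> fin_cases j
  · simpa using h0.1
  · simpa using h1.1
  · simpa [eq_div_iff hz, mul_comm] using h0.2
  · simpa [hz] using h1.2

/-- At `z = i √6 ^ (n + 1)` the string parameter is `6 ^ (n + 1)`. Off-diagonal entries are
controlled by the upper left entry one scale lower, whence the exponent `2 ^ n` for all four. -/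
theorem entireOrder_monodromy {M : ℂ → ℝ → Matrix (Fin 2) (Fin 2) ℂ}
    (hM : IsMatrixSolution cantorHamiltonian 2 M) (i j : Fin 2) :
    entireOrder (fun z => M z 2 i j) = ((2 / Real.logb 2 6 : ℝ) : EReal) := by
  obtain ⟨X, hX, hXb⟩ := exists_norm_cantorEntry_mul_le
  refine entireOrder_eq_of_bounds hX (c := 7 / 6) (by norm_num) (fun n z hz hzn => ?_) ?_
  · have hz0 : 0 < ‖z‖ := by linarith
    have hb : ∀ i j, ‖cantorEntry (-z ^ 2) i j‖ ≤ X ^ 2 ^ n := fun i j =>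
      (le_mul_of_one_le_right (norm_nonneg _) (one_le_pow₀ (by norm_num))).trans
        (hXb n (-z ^ 2) (by rwa [norm_neg, norm_pow]) i j)
    have hX0 : 0 ≤ X ^ 2 ^ n := by positivity
    have hz' : X ^ 2 ^ n ≤ ‖z‖ * X ^ 2 ^ n := le_mul_of_one_le_left hX0 hz
    rw [hM.apply_two (norm_pos_iff.1 hz0)]
    fin_cases i <;> fin_cases j
    · exact (hb 0 0).trans hz'
    · change ‖z * cantorEntry (-z ^ 2) 0 1‖ ≤ _
      rw [norm_mul]
      exact mul_le_mul_of_nonneg_left (hb 0 1) hz0.le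
    · change ‖cantorEntry (-z ^ 2) 1 0 / z‖ ≤ _
      rw [norm_div]
      exact ((div_le_self (norm_nonneg _) hz).trans (hb 1 0)).trans hz'
    · exact (hb 1 1).trans hz'
  · filter_upwards [eventually_ge_atTop 1] with n hn
    set y := Real.sqrt 6 ^ (n + 1) with hy
    set z : ℂ := Complex.I * (y : ℝ) with hz
    have hy2 : y ^ 2 = 6 ^ (n + 1) := by
      rw [hy, ← pow_mul, mul_comm, pow_mul, Real.sq_sqrt (by norm_num)]
    have hy0 : 0 < y := by positivity
    -- This absorbs the constants `1/2` and `1/3` in the bounds for the off-diagonal entries.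
    have hy3 : 3 ≤ y := by
      have h6 : (6 : ℝ) ^ 2 ≤ 6 ^ (n + 1) := pow_le_pow_right₀ (by norm_num) (by omega)
      refine le_of_sq_le_sq ?_ hy0.le
      rw [hy2]
      linarith
    have hzw : -z ^ 2 = ((6 ^ (n + 1) : ℝ) : ℂ) := by
      rw [hz, mul_pow, Complex.I_sq, ← hy2]; push_cast; ring
    have hzn : ‖z‖ = y := by
      rw [hz, norm_mul, Complex.norm_I, one_mul, Complex.norm_real, Real.norm_of_nonneg hy0.le]
    have hz0 : z ≠ 0 := norm_pos_iff.1 (hzn ▸ hy0)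
    have hpow : (7 / 6 : ℝ) ^ 2 ^ n ≤ (7 / 6) ^ 2 ^ (n + 1) :=
      pow_le_pow_right₀ (by norm_num) (Nat.pow_le_pow_right (by norm_num) (Nat.le_succ n))
    have hP := (pow_le_norm_cantorEntry n).1
    have hn1 := pow_le_norm_cantorEntry (n + 1)
    obtain ⟨-, -, -, -, h01, h10⟩ := le_norm_cantorEntry (r := 6 ^ (n + 1)) (by positivity)
    rw [show (6 : ℝ) ^ (n + 1) / 6 = 6 ^ n by rw [pow_succ]; ring] at h01 h10
    rw [hM.apply_two hz0, hzw]
    fin_cases i <;> fin_cases j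
    · exact hpow.trans hn1.1
    · change _ ≤ ‖z * cantorEntry _ 0 1‖
      rw [norm_mul, hzn]
      have := mul_le_mul_of_nonneg_right hy3 (norm_nonneg (cantorEntry ((6 ^ (n + 1) : ℝ) : ℂ) 0 1))
      have := norm_nonneg (cantorEntry ((6 ^ n : ℝ) : ℂ) 0 0)
      linarith
    · change _ ≤ ‖cantorEntry _ 1 0 / z‖
      rw [norm_div, hzn, le_div_iff₀ hy0]
      refine le_trans ?_ h10
      rw [← hy2, mul_comm]
      refine mul_le_mul ?_ hP (by positivity) (by positivity)
      rw [sq]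
      have := mul_le_mul_of_nonneg_left hy3 hy0.le
      linarith
    · exact hpow.trans hn1.2

/-! ### The Hamiltonian is a canonical system; conclusion -/

theorem isCanonicalSystem_cantorHamiltonian : IsCanonicalSystem cantorHamiltonian 2 := by
  refine ⟨two_pos, fun i j => ?_, Eventually.of_forall fun x => ?_,
    Eventually.of_forall fun x => ?_⟩
  · have hm : (fun x => cantorHamiltonian x i j) =
        cantorStringSet.indicator (fun _ => !![(1 : ℂ), 0; 0, 0] i j) +
          cantorStringSetᶜ.indicator (fun _ => !![(0 : ℂ), 0; 0, 1] i j) := by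
      ext x
      by_cases h : x ∈ cantorStringSet <;> simp [cantorHamiltonian, h]
    have hc : ∀ c : ℂ, IntegrableOn (fun _ : ℝ => c) (Icc 0 2) := fun c =>
      continuousOn_const.integrableOn_Icc
    rw [hm]
    exact ((hc _).indicator measurableSet_cantorStringSet).add
      ((hc _).indicator measurableSet_cantorStringSet.compl)
  · have h1 : (!![1, 0; 0, 0] : Matrix (Fin 2) (Fin 2) ℂ) = Matrix.diagonal ![1, 0] := by
      ext i j; fin_cases i <;> fin_cases j <;> rfl
    have h2 : (!![0, 0; 0, 1] : Matrix (Fin 2) (Fin 2) ℂ) = Matrix.diagonal ![0, 1] := by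
      ext i j; fin_cases i <;> fin_cases j <;> rfl
    unfold cantorHamiltonian
    split_ifs
    · rw [h1]
      exact Matrix.PosSemidef.diagonal fun i => by fin_cases i <;> simp
    · rw [h2]
      exact Matrix.PosSemidef.diagonal fun i => by fin_cases i <;> simp
  · unfold cantorHamiltonian
    split_ifs <;> simp [Matrix.trace_fin_two]

theorem mainTheorem7 :
    IsCanonicalSystem cantorHamiltonian 2 ∧
      HasOrder cantorHamiltonian 2 ((2 / Real.logb 2 6 : ℝ) : EReal) :=
  ⟨isCanonicalSystem_cantorHamiltonian, exists_isMatrixSolution, fun _ hM =>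
    entireOrder_monodromy hM⟩
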